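/- Let $\mathcal H$ be a separable complex Hilbert space and $\mathcal H_N=\mathcal H^{\otimes N}$ its $N$-fold Hilbert space tensor power. A density matrix on a Hilbert space is a positive operator of trace $1$. Let $h$ be a (possibly unbounded) self-adjoint operator on $\mathcal H$ that is bounded below and has compact resolvent, and let $H_N=\sum_{j=1}^N h_j$, where $h_j$ is $h$ acting on the $j$-th factor. A collision specification $(\mathcal C,U,\nu)$ consists of a compact metric space $\mathcal C$, a strongly continuous (in particular, possibly norm-continuous) injective map $U$ from $\mathcal C$ to the unitary operators on $\mathcal H_2$, and a Borel probability measure $\nu$ on $\mathcal C$ that charges all nonempty open sets, such that: (i) each $U(\sigma)$ commutes with $H_2$; (ii) $U(\sigma_0)=1$ for some $\sigma_0$; (iii) $\{U(\sigma)\}=\{U(\sigma)^*\}$, and the map $\sigma\mapsto\sigma'$ with $U(\sigma)^*=U(\sigma')$ is measurable and leaves $\nu$ invariant; (iv) with the swap $V(\phi\otimes\psi)=\psi\otimes\phi$, $\{U(\sigma)\}=\{VU(\sigma)V^*\}$, and the map $\sigma\mapsto\sigma'$ with $VU(\sigma)V^*=U(\sigma')$ is measurable and leaves $\nu$ invariant.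 It is ergodic if the commutant $\{U(\sigma):\sigma\in\mathcal C\}'$ equals the energy algebra $\mathcal A_2$ of all operators $f(H_2)$, $f$ bounded on the spectrum of $H_2$. For $N\ge 2$ and bounded operators $A$ on $\mathcal H_N$ let $$\mathcal Q_{i,j}A=\int_{\mathcal C}U_{i,j}(\sigma)\,A\,U_{i,j}(\sigma)^*\,d\nu(\sigma),\qquad \mathcal Q_N=\binom N2^{-1}\sum_{i<j}\mathcal Q_{i,j},\qquad \mathcal L_N=N(\mathcal Q_N-1),$$ where $U_{i,j}(\sigma)$ is $U(\sigma)$ acting on the $i$-th and $j$-th factors. The quantum Kac Master Equation is $\frac{d}{dt}\varrho=\mathcal L_N\varrho$, solved by $e^{t\mathcal L_N}\varrho_0$. A density matrix on $\mathcal H_N$ is a product state if it is $\rho_1\otimes\cdots\otimes\rho_N$ with density matrices $\rho_j$ on $\mathcal H$, and it is separable if it lies in the trace-norm closed convex hull of the product states. **Corollary.** Let $(\mathcal C,U,\nu)$ be an ergodic collision specification and $N\ge2$. Then every density matrix $\varrho$ on $\mathcal H_N$ with $\mathcal L_N\varrho=0$ is separable. Consequently the evolution destroys all entanglement in the long-time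 limit: for every density matrix $\varrho_0$ on $\mathcal H_N$ there is a separable density matrix $\varrho_\infty$ with $\mathcal L_N\varrho_\infty=0$ and $\lim_{t\to\infty}\|e^{t\mathcal L_N}\varrho_0-\varrho_\infty\|_1=0$, where $\|A\|_1=\mathrm{Tr}\,(A^*A)^{1/2}$. -/

import Mathlib

open scoped InnerProductSpace
open MeasureTheory Filter Topology

noncomputable section

namespace QuantumKac

section SquareSummable
variable {X Y Z : Type*}

/-- The Hilbert space of square-summable complex families indexed by `X`. -/
abbrev L2 (X : Type*) : Type _ := lp (fun _ : X => ℂ) 2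

theorem memL2_iff {f : X → ℂ} : Memℓp f 2 ↔ Summable fun x => ‖f x‖ ^ 2 := by
  rw [memℓp_gen_iff (by norm_num)]
  simp

theorem L2.summable (f : L2 X) : Summable fun x => ‖f x‖ ^ 2 := memL2_iff.1 f.2

theorem L2.norm_sq (f : L2 X) : ‖f‖ ^ 2 = ∑' x, ‖f x‖ ^ 2 := by
  have := lp.norm_rpow_eq_tsum (p := 2) (by norm_num) f
  simpa using this

theorem L2.inner_eq (f g : L2 X) : ⟪f, g⟫_ℂ = ∑' x, starRingEnd ℂ (f x) * g x := by
  rw [lp.inner_eq_tsum]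
  exact tsum_congr fun x => by rw [RCLike.inner_apply']

theorem L2.summable_norm_mul (f g : L2 X) : Summable fun x => ‖starRingEnd ℂ (f x) * g x‖ := by
  refine Summable.of_nonneg_of_le (fun x => norm_nonneg _) (fun x => ?_)
    ((L2.summable f).add (L2.summable g))
  rw [norm_mul, RCLike.norm_conj]
  nlinarith [sq_nonneg (‖f x‖ - ‖g x‖), sq_nonneg (‖f x‖), sq_nonneg (‖g x‖)]

/-- For an identification `Z ≃ X × Y`, the section `x ↦ f (x, y)` of a square-summable family. -/
def slice (e : Z ≃ X × Y) (y : Y) : L2 Z →ₗ[ℂ] L2 X where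
  toFun f := ⟨fun x => f (e.symm (x, y)), memL2_iff.2 <|
    (L2.summable f).comp_injective (i := fun x => e.symm (x, y)) fun a b hab => by simpa using hab⟩
  map_add' _ _ := rfl
  map_smul' _ _ := rfl

theorem slice_apply (e : Z ≃ X × Y) (y : Y) (f : L2 Z) (x : X) :
    slice e y f x = f (e.symm (x, y)) := rfl

theorem summable_slice (e : Z ≃ X × Y) (f : L2 Z) : Summable fun y => ‖slice e y f‖ ^ 2 := by
  have h1 : Summable fun p : Y × X => ‖f (e.symm (p.2, p.1))‖ ^ 2 :=
    (((Equiv.prodComm Y X).trans e.symm).summable_iff (f := fun z => ‖f z‖ ^ 2)).2 (L2.summable f)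
  simp only [L2.norm_sq]
  exact h1.prod

theorem tsum_slice (e : Z ≃ X × Y) (f : L2 Z) : ∑' y, ‖slice e y f‖ ^ 2 = ‖f‖ ^ 2 := by
  have h1 : Summable fun p : Y × X => ‖f (e.symm (p.2, p.1))‖ ^ 2 :=
    (((Equiv.prodComm Y X).trans e.symm).summable_iff (f := fun z => ‖f z‖ ^ 2)).2 (L2.summable f)
  rw [L2.norm_sq f, ← ((Equiv.prodComm Y X).trans e.symm).tsum_eq (fun z => ‖f z‖ ^ 2)]
  simp only [L2.norm_sq]
  exact (h1.tsum_prod).symm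

/-- A family of square-summable sections with summable squared norms is square-summable. -/
theorem memL2_of_slices (e : Z ≃ X × Y) (g : Y → L2 X) (hg : Summable fun y => ‖g y‖ ^ 2) :
    Memℓp (fun z : Z => g (e z).2 (e z).1) 2 := by
  rw [memL2_iff]
  have h2 : Summable fun p : Y × X => ‖g p.1 p.2‖ ^ 2 := by
    rw [summable_prod_of_nonneg (fun p => by positivity)]
    exact ⟨fun y => L2.summable (g y), by simpa [L2.norm_sq] using hg⟩
  exact ((e.trans (Equiv.prodComm X Y)).summable_iff (f := fun p : Y × X => ‖g p.1 p.2‖ ^ 2)).2 h2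

theorem summable_map_slice (e : Z ≃ X × Y) (A : L2 X →L[ℂ] L2 X) (f : L2 Z) :
    Summable fun y => ‖A (slice e y f)‖ ^ 2 := by
  refine Summable.of_nonneg_of_le (fun y => by positivity) (fun y => ?_)
    ((summable_slice e f).mul_left (‖A‖ ^ 2))
  rw [← mul_pow]
  gcongr
  exact A.le_opNorm _

/-- For an identification `Z ≃ X × Y`, hence `ℓ²(Z) = ℓ²(X) ⊗ ℓ²(Y)`, the operator `A ⊗ 1`, as a
linear map: it applies `A` to each section. -/
def tensorOneLin (e : Z ≃ X × Y) (A : L2 X →L[ℂ] L2 X) : L2 Z →ₗ[ℂ] L2 Z where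
  toFun f := ⟨fun z => A (slice e (e z).2 f) (e z).1,
    memL2_of_slices e (fun y => A (slice e y f)) (summable_map_slice e A f)⟩
  map_add' f g := by
    ext z
    simp
    rfl
  map_smul' c f := by
    ext z
    simp

theorem slice_tensorOneLin (e : Z ≃ X × Y) (A : L2 X →L[ℂ] L2 X) (f : L2 Z) (y : Y) :
    slice e y (tensorOneLin e A f) = A (slice e y f) := by
  ext x
  simp [slice_apply, tensorOneLin]

theorem norm_tensorOneLin_le (e : Z ≃ X × Y) (A : L2 X →L[ℂ] L2 X) (f : L2 Z) :
    ‖tensorOneLin e A f‖ ≤ ‖A‖ * ‖f‖ := by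
  refine le_of_sq_le_sq ?_ (by positivity)
  rw [mul_pow, ← tsum_slice e, ← tsum_slice e f, ← tsum_mul_left]
  simp only [slice_tensorOneLin]
  refine (summable_map_slice e A f).tsum_le_tsum (fun y => ?_)
    ((summable_slice e f).mul_left (‖A‖ ^ 2))
  rw [← mul_pow]
  gcongr
  exact A.le_opNorm _

/-- The bounded operator `A ⊗ 1` on `ℓ²(Z) = ℓ²(X) ⊗ ℓ²(Y)`. -/
def tensorOne (e : Z ≃ X × Y) (A : L2 X →L[ℂ] L2 X) : L2 Z →L[ℂ] L2 Z :=
  (tensorOneLin e A).mkContinuous ‖A‖ (norm_tensorOneLin_le e A)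

theorem slice_tensorOne (e : Z ≃ X × Y) (A : L2 X →L[ℂ] L2 X) (f : L2 Z) (y : Y) :
    slice e y (tensorOne e A f) = A (slice e y f) := slice_tensorOneLin e A f y

theorem ext_slice (e : Z ≃ X × Y) {f g : L2 Z} (h : ∀ y, slice e y f = slice e y g) : f = g := by
  ext z
  have := congrArg (fun k : L2 X => k (e z).1) (h (e z).2)
  simpa [slice_apply] using this

theorem inner_eq_tsum_slice (e : Z ≃ X × Y) (f g : L2 Z) :
    ⟪f, g⟫_ℂ = ∑' y, ⟪slice e y f, slice e y g⟫_ℂ := by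
  have h1 : Summable fun p : Y × X => ⟪f (e.symm (p.2, p.1)), g (e.symm (p.2, p.1))⟫_ℂ :=
    (((Equiv.prodComm Y X).trans e.symm).summable_iff (f := fun z => ⟪f z, g z⟫_ℂ)).2
      (lp.summable_inner f g)
  rw [lp.inner_eq_tsum f g, ← ((Equiv.prodComm Y X).trans e.symm).tsum_eq]
  simp only [lp.inner_eq_tsum]
  exact h1.tsum_prod

theorem star_tensorOne (e : Z ≃ X × Y) (A : L2 X →L[ℂ] L2 X) :
    star (tensorOne e A) = tensorOne e (star A) := by
  rw [ContinuousLinearMap.star_eq_adjoint, ContinuousLinearMap.star_eq_adjoint, eq_comm,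
    ContinuousLinearMap.eq_adjoint_iff]
  intro f g
  rw [inner_eq_tsum_slice e, inner_eq_tsum_slice e]
  simp [slice_tensorOne, ContinuousLinearMap.adjoint_inner_left]

theorem tensorOne_mul (e : Z ≃ X × Y) (A B : L2 X →L[ℂ] L2 X) :
    tensorOne e (A * B) = tensorOne e A * tensorOne e B := by
  ext1 f
  refine ext_slice e fun y => ?_
  simp [slice_tensorOne]

theorem tensorOne_one (e : Z ≃ X × Y) : tensorOne e (1 : L2 X →L[ℂ] L2 X) = 1 := by
  ext1 f
  refine ext_slice e fun y => ?_
  simp [slice_tensorOne]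

/-- `A ↦ A ⊗ 1` maps strongly continuous families of contractions to strongly continuous ones. -/
theorem continuous_tensorOne {C : Type*} [TopologicalSpace C] (e : Z ≃ X × Y)
    (A : C → L2 X →L[ℂ] L2 X) (hA : ∀ σ, ‖A σ‖ ≤ 1) (hc : ∀ x, Continuous fun σ => A σ x)
    (f : L2 Z) : Continuous fun σ => tensorOne e (A σ) f := by
  rw [continuous_iff_continuousAt]
  intro τ
  have key : Continuous fun σ => ∑' y, ‖A σ (slice e y f) - A τ (slice e y f)‖ ^ 2 := by
    refine continuous_tsum (u := fun y => 4 * ‖slice e y f‖ ^ 2)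
      (fun y => (((hc _).sub continuous_const).norm).pow 2)
      ((summable_slice e f).mul_left 4) fun y σ => ?_
    have h1 : ‖A σ (slice e y f) - A τ (slice e y f)‖ ≤ 2 * ‖slice e y f‖ := by
      refine (norm_sub_le _ _).trans ?_
      have := (A σ).le_of_opNorm_le (hA σ) (slice e y f)
      have := (A τ).le_of_opNorm_le (hA τ) (slice e y f)
      linarith
    rw [Real.norm_of_nonneg (by positivity)]
    calc _ ≤ (2 * ‖slice e y f‖) ^ 2 := by gcongr
      _ = _ := by ring
  have hk : ∀ σ, ‖tensorOne e (A σ) f - tensorOne e (A τ) f‖ ^ 2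
      = ∑' y, ‖A σ (slice e y f) - A τ (slice e y f)‖ ^ 2 := fun σ => by
    rw [← tsum_slice e]
    simp [slice_tensorOne]
  rw [ContinuousAt, tendsto_iff_norm_sub_tendsto_zero]
  have h0 := key.tendsto τ
  simp only [sub_self, norm_zero, ne_eq, OfNat.ofNat_ne_zero, not_false_eq_true, zero_pow,
    tsum_zero] at h0
  simp only [← hk] at h0
  have := h0.sqrt
  simpa using this

end SquareSummable

section TensorPower

/-- Absolutely convergent families satisfy `∑_α ∏_k f_k(α_k) = ∏_k ∑_j f_k(j)`. -/
theorem summable_tsum_prod_fin {J : Type*} : ∀ (n : ℕ) (f : Fin n → J → ℂ),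
    (∀ k, Summable fun j => ‖f k j‖) →
      (Summable fun α : Fin n → J => ‖∏ k, f k (α k)‖) ∧
        ∑' α : Fin n → J, ∏ k, f k (α k) = ∏ k, ∑' j, f k j
  | 0, f, _ => by
    refine ⟨(hasSum_fintype _).summable, ?_⟩
    simp
  | n + 1, f, hf => by
    obtain ⟨h1, h2⟩ := summable_tsum_prod_fin n (fun k => f k.succ) fun k => hf k.succ
    have hs := (hf 0).mul_norm h1
    have he : ∀ p : J × (Fin n → J), ∏ k, f k (Fin.consEquiv (fun _ => J) p k)
        = f 0 p.1 * ∏ k : Fin n, f k.succ (p.2 k) := fun p => by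
      simp [Fin.prod_univ_succ, Fin.consEquiv]
    constructor
    · rw [← (Fin.consEquiv fun _ : Fin (n + 1) => J).summable_iff]
      simpa only [Function.comp_def, he] using hs
    · rw [← (Fin.consEquiv fun _ : Fin (n + 1) => J).tsum_eq]
      simp only [he]
      rw [Fin.prod_univ_succ, ← h2, tsum_mul_tsum_of_summable_norm (hf 0) h1]

theorem summable_tsum_prod {ι J : Type*} [Fintype ι] (f : ι → J → ℂ)
    (hf : ∀ k, Summable fun j => ‖f k j‖) :
    (Summable fun α : ι → J => ‖∏ k, f k (α k)‖) ∧
      ∑' α : ι → J, ∏ k, f k (α k) = ∏ k, ∑' j, f k j := by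
  let e := Fintype.equivFin ι
  obtain ⟨h1, h2⟩ := summable_tsum_prod_fin (Fintype.card ι) (fun k => f (e.symm k))
    fun k => hf _
  have he : ∀ α : Fin (Fintype.card ι) → J, ∏ k, f k ((Equiv.arrowCongr e.symm (Equiv.refl J)) α k)
      = ∏ k, f (e.symm k) (α k) := fun α => by
    rw [← e.symm.prod_comp]
    simp [Equiv.arrowCongr]
  constructor
  · rw [← (Equiv.arrowCongr e.symm (Equiv.refl J)).summable_iff]
    simpa only [Function.comp_def, he] using h1
  · rw [← (Equiv.arrowCongr e.symm (Equiv.refl J)).tsum_eq]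
    simp only [he]
    rw [h2, e.symm.prod_comp (fun k => ∑' j, f k j)]

variable (H : Type*) [NormedAddCommGroup H] [InnerProductSpace ℂ H] [CompleteSpace H]

/-- The index set of a fixed orthonormal basis of `H`. -/
def OnbIdx : Set H := (exists_hilbertBasis ℂ H).choose

/-- A fixed orthonormal (Hilbert) basis of `H`. -/
def onb : HilbertBasis (OnbIdx H) ℂ H := (exists_hilbertBasis ℂ H).choose_spec.choose

/-- The Hilbert space tensor power `H^{⊗N}`, realised through coordinates with respect to a fixed
orthonormal basis of `H`. With `productVector` below it is characterised, up to a unique unitary, by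
`inner_productVector` and `dense_span_productVector`. -/
abbrev TensorPower (N : ℕ) : Type _ := L2 (Fin N → OnbIdx H)

variable {H}

theorem summable_onb (φ : H) : Summable fun j => ‖(onb H).repr φ j‖ ^ 2 := L2.summable _

/-- The product vector `φ_1 ⊗ ⋯ ⊗ φ_N`. -/
def productVector {N : ℕ} (φ : Fin N → H) : TensorPower H N :=
  ⟨fun α => ∏ k, (onb H).repr (φ k) (α k), memL2_iff.2 <| by
    have := (summable_tsum_prod (fun k j => ((onb H).repr (φ k) j) ^ 2)
      fun k => by simpa using summable_onb (φ k)).1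
    simpa [Finset.prod_pow] using this⟩

theorem productVector_apply {N : ℕ} (φ : Fin N → H) (α : Fin N → OnbIdx H) :
    productVector φ α = ∏ k, (onb H).repr (φ k) (α k) := rfl

theorem inner_eq_tsum_onb (φ χ : H) :
    ⟪φ, χ⟫_ℂ = ∑' j, starRingEnd ℂ ((onb H).repr φ j) * (onb H).repr χ j := by
  rw [← L2.inner_eq, LinearIsometryEquiv.inner_map_map]

theorem inner_productVector {N : ℕ} (φ χ : Fin N → H) :
    ⟪productVector φ, productVector χ⟫_ℂ = ∏ k, ⟪φ k, χ k⟫_ℂ := by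
  have h2 := (summable_tsum_prod
    (fun k j => starRingEnd ℂ ((onb H).repr (φ k) j) * (onb H).repr (χ k) j) fun k =>
    L2.summable_norm_mul ((onb H).repr (φ k)) ((onb H).repr (χ k))).2
  simp only [← inner_eq_tsum_onb] at h2
  rw [L2.inner_eq, ← h2]
  refine tsum_congr fun α => ?_
  simp only [productVector_apply, Finset.prod_mul_distrib, map_prod]

theorem dense_span_productVector (N : ℕ) :
    Dense (Submodule.span ℂ (Set.range (productVector : (Fin N → H) → TensorPower H N)) :
      Set (TensorPower H N)) := by
  classical
  let b : HilbertBasis (Fin N → OnbIdx H) ℂ (TensorPower H N) :=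
    ⟨LinearIsometryEquiv.refl ℂ _⟩
  have hb : ∀ α, b α = productVector fun k => onb H (α k) := fun α => by
    ext β
    have h1 : b α = lp.single 2 α (1 : ℂ) := by
      rw [← b.repr_symm_single]
      rfl
    rw [h1, productVector_apply]
    simp only [HilbertBasis.repr_self, lp.single_apply, Pi.single_apply]
    by_cases hβ : β = α
    · subst hβ
      simp
    · obtain ⟨k, hk⟩ := Function.ne_iff.1 hβ
      rw [if_neg hβ, Finset.prod_eq_zero (Finset.mem_univ k)]
      simp [hk]
  have h2 := b.dense_span
  rw [← Submodule.dense_iff_topologicalClosure_eq_top] at h2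
  refine h2.mono (Submodule.span_mono ?_)
  rintro _ ⟨α, rfl⟩
  exact ⟨_, (hb α).symm⟩

/-- Splitting a multi-index into its entries at two distinct positions `i`, `j` (in this order)
and the remaining ones. -/
def pairSplit {N : ℕ} (J : Type*) (i j : Fin N) (hij : i ≠ j) :
    (Fin N → J) ≃ (Fin 2 → J) × ({k : Fin N // k ≠ i ∧ k ≠ j} → J) where
  toFun α := (![α i, α j], fun k => α k)
  invFun p k := if hi : k = i then p.1 0 else if hj : k = j then p.1 1 else p.2 ⟨k, hi, hj⟩
  left_inv α := by
    funext k
    by_cases hi : k = i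
    · simp [hi]
    · by_cases hj : k = j
      · subst hj
        simp [hi]
      · simp [hi, hj]
  right_inv p := by
    refine Prod.ext ?_ ?_
    · funext m
      fin_cases m <;> simp [hij.symm]
    · funext k
      simp [k.2.1, k.2.2]

/-- For an operator `A` on `H ⊗ H`, the operator `A_{i,j}` on `H^{⊗N}`, which acts as `A` on
the `i`-th and `j`-th factors and trivially on the others. -/
def pairOp {N : ℕ} (i j : Fin N) (hij : i ≠ j) (A : TensorPower H 2 →L[ℂ] TensorPower H 2) :
    TensorPower H N →L[ℂ] TensorPower H N :=
  tensorOne (pairSplit _ i j hij) A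

theorem slice_productVector {N : ℕ} (i j : Fin N) (hij : i ≠ j) (φ : Fin N → H)
    (y : {k : Fin N // k ≠ i ∧ k ≠ j} → OnbIdx H) :
    slice (pairSplit _ i j hij) y (productVector φ)
      = (∏ k, (onb H).repr (φ k.1) (y k)) • productVector ![φ i, φ j] := by
  ext x
  have hj : j ∈ Finset.univ.erase i := by simp [hij.symm]
  have hs : ((Finset.univ.erase i).erase j) = Finset.univ.filter fun k => k ≠ i ∧ k ≠ j := by
    ext k
    simp [and_comm]
  have hp := Finset.prod_subtype (p := fun k => k ≠ i ∧ k ≠ j) (F := inferInstance)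
    (Finset.univ.filter fun k => k ≠ i ∧ k ≠ j) (by simp)
    fun k => (onb H).repr (φ k) ((pairSplit (OnbIdx H) i j hij).symm (x, y) k)
  rw [slice_apply, productVector_apply, ← Finset.mul_prod_erase _ _ (Finset.mem_univ i),
    ← Finset.mul_prod_erase _ _ hj, hs, hp]
  have h0 : ∀ k : {k : Fin N // k ≠ i ∧ k ≠ j},
      (pairSplit (OnbIdx H) i j hij).symm (x, y) k = y k := fun k => by
    simp [pairSplit, k.2.1, k.2.2]
  simp only [h0]
  simp [productVector_apply, Fin.prod_univ_two, pairSplit, hij.symm]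
  ring

/-- The matrix elements of `A_{i,j}` between product vectors; they determine `A_{i,j}`. -/
theorem inner_productVector_pairOp {N : ℕ} (i j : Fin N) (hij : i ≠ j)
    (A : TensorPower H 2 →L[ℂ] TensorPower H 2) (χ φ : Fin N → H) :
    ⟪productVector χ, pairOp i j hij A (productVector φ)⟫_ℂ
      = ⟪productVector ![χ i, χ j], A (productVector ![φ i, φ j])⟫_ℂ
        * ∏ k : {k : Fin N // k ≠ i ∧ k ≠ j}, ⟪χ k, φ k⟫_ℂ := by
  have h2 := (summable_tsum_prod (ι := {k : Fin N // k ≠ i ∧ k ≠ j})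
    (fun k m => starRingEnd ℂ ((onb H).repr (χ k) m) * (onb H).repr (φ k) m) fun k =>
    L2.summable_norm_mul ((onb H).repr (χ k)) ((onb H).repr (φ k))).2
  simp only [← inner_eq_tsum_onb] at h2
  rw [inner_eq_tsum_slice (pairSplit _ i j hij), ← h2, ← tsum_mul_left]
  refine tsum_congr fun y => ?_
  simp only [pairOp, slice_tensorOne, slice_productVector, map_smul, inner_smul_left, inner_smul_right,
    Finset.prod_mul_distrib, map_prod]
  ring

/-- The reindexing `f ↦ f ∘ e` of square-summable families. -/
def reindex {X : Type*} (e : X ≃ X) : L2 X →L[ℂ] L2 X :=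
  LinearMap.mkContinuous
    { toFun := fun f => (⟨fun x => f (e x), memL2_iff.2 <|
        (L2.summable f).comp_injective e.injective⟩ : L2 X)
      map_add' := fun _ _ => rfl
      map_smul' := fun _ _ => rfl } 1 fun f => by
    rw [one_mul]
    refine le_of_sq_le_sq (le_of_eq ?_) (norm_nonneg _)
    rw [L2.norm_sq, L2.norm_sq]
    exact e.tsum_eq (fun x => ‖f x‖ ^ 2)

/-- The swap `V (φ ⊗ ψ) = ψ ⊗ φ` on `H ⊗ H`. -/
def swap : TensorPower H 2 →L[ℂ] TensorPower H 2 :=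
  reindex (Equiv.arrowCongr (Equiv.swap (0 : Fin 2) 1) (Equiv.refl (OnbIdx H)))

theorem swap_productVector (φ ψ : H) : swap (productVector ![φ, ψ]) = productVector ![ψ, φ] := by
  ext α
  change productVector ![φ, ψ] (fun k => α (Equiv.swap 0 1 k)) = _
  simp [productVector_apply, Fin.prod_univ_two, mul_comm]

end TensorPower

section States

variable {K : Type*} [NormedAddCommGroup K] [InnerProductSpace ℂ K] [CompleteSpace K]

/-- The trace `∑_j ⟨b_j, T b_j⟩ ∈ [0, ∞]` of a positive operator `T` (`b` an orthonormal basis). -/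
def posTrace (T : K →L[ℂ] K) : ENNReal :=
  ∑' j, ENNReal.ofReal (RCLike.re ⟪onb K j, T (onb K j)⟫_ℂ)

/-- The Parseval identity, in `[0, ∞]`. -/
theorem tsum_ofReal_norm_inner_sq {ι E : Type*} [NormedAddCommGroup E]
    [InnerProductSpace ℂ E] (b : HilbertBasis ι ℂ E) (x : E) :
    ∑' j, ENNReal.ofReal (‖⟪b j, x⟫_ℂ‖ ^ 2) = ENNReal.ofReal (‖x‖ ^ 2) := by
  have h := L2.summable (b.repr x)
  rw [← LinearIsometryEquiv.norm_map b.repr x, L2.norm_sq,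
    ENNReal.ofReal_tsum_of_nonneg (fun _ => by positivity) h]
  simp [HilbertBasis.repr_apply_apply]

/-- The trace of a positive operator does not depend on the orthonormal basis. -/
theorem posTrace_eq {ι : Type*} (b : HilbertBasis ι ℂ K) {T : K →L[ℂ] K} (hT : T.IsPositive) :
    posTrace T = ∑' j, ENNReal.ofReal (RCLike.re ⟪b j, T (b j)⟫_ℂ) := by
  have hT' : 0 ≤ T := (ContinuousLinearMap.nonneg_iff_isPositive T).2 hT
  let S := CFC.sqrt T
  have hS : IsSelfAdjoint S := (CFC.sqrt_nonneg T).isSelfAdjoint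
  have hS2 : S * S = T := CFC.sqrt_mul_sqrt_self T
  have hin : ∀ x y : K, ⟪S x, y⟫_ℂ = ⟪x, S y⟫_ℂ := fun x y => by
    rw [← ContinuousLinearMap.adjoint_inner_right, ← ContinuousLinearMap.star_eq_adjoint, hS.star_eq]
  have h1 : ∀ x : K, RCLike.re ⟪x, T x⟫_ℂ = ‖S x‖ ^ 2 := fun x => by
    rw [← hS2, mul_apply_eq_comp, ← hin, inner_self_eq_norm_sq]
  simp only [posTrace, h1]
  calc _ = ∑' i, ∑' j, ENNReal.ofReal (‖⟪b j, S (onb K i)⟫_ℂ‖ ^ 2) := by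
        simp only [tsum_ofReal_norm_inner_sq]
    _ = ∑' j, ∑' i, ENNReal.ofReal (‖⟪b j, S (onb K i)⟫_ℂ‖ ^ 2) := ENNReal.tsum_comm
    _ = ∑' j, ∑' i, ENNReal.ofReal (‖⟪onb K i, S (b j)⟫_ℂ‖ ^ 2) := by
        refine tsum_congr fun j => tsum_congr fun i => ?_
        rw [← hin, norm_inner_symm]
    _ = _ := by simp only [tsum_ofReal_norm_inner_sq]

/-- The trace norm `‖A‖₁ = Tr |A| = Tr (A* A)^{1/2} ∈ [0, ∞]`; `A` is of trace class if and only if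
it is finite. -/
def traceNorm (A : K →L[ℂ] K) : ENNReal := posTrace (CFC.abs A)

/-- Density matrices: positive operators of trace one. -/
def IsDensity (ϱ : K →L[ℂ] K) : Prop := ϱ.IsPositive ∧ posTrace ϱ = 1

variable {H : Type*} [NormedAddCommGroup H] [InnerProductSpace ℂ H] [CompleteSpace H]

/-- Product states: density matrices `ϱ = ρ_1 ⊗ ⋯ ⊗ ρ_N` on `H^{⊗N}`, where each `ρ_j` is a density
matrix on `H`. -/
def productStates (H : Type*) [NormedAddCommGroup H] [InnerProductSpace ℂ H] [CompleteSpace H]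
    (N : ℕ) : Set (TensorPower H N →L[ℂ] TensorPower H N) :=
  {ϱ | IsDensity ϱ ∧ ∃ ρ : Fin N → H →L[ℂ] H, (∀ j, IsDensity (ρ j)) ∧
    ∀ φ : Fin N → H, ϱ (productVector φ) = productVector fun j => ρ j (φ j)}

/-- Separable states: density matrices in the closed convex hull (for the trace norm) of the
product states. -/
def IsSeparable {N : ℕ} (ϱ : TensorPower H N →L[ℂ] TensorPower H N) : Prop :=
  IsDensity ϱ ∧ ∀ ε : ENNReal, 0 < ε →
    ∃ ω ∈ convexHull ℝ (productStates H N), traceNorm (ϱ - ω) < ε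

end States

section Hamiltonian

variable {H : Type*} [NormedAddCommGroup H] [InnerProductSpace ℂ H] [CompleteSpace H]

/-- Single-particle Hamiltonians: (possibly unbounded) self-adjoint operators that are bounded
below and have compact resolvent. Their eigenvalues, repeated according to multiplicity, can be
arranged in an increasing sequence, finite or tending to `+∞`. -/
structure Hamiltonian (H : Type*) [NormedAddCommGroup H] [InnerProductSpace ℂ H]
    [CompleteSpace H] where
  /-- the operator, with its domain -/
  op : H →ₗ.[ℂ] H
  selfAdjoint : IsSelfAdjoint op
  boundedBelow : ∃ c : ℝ, ∀ x : op.domain, c * ‖(x : H)‖ ^ 2 ≤ RCLike.re ⟪(x : H), op x⟫_ℂ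
  /-- `(h - z)⁻¹` exists and is compact for some real `z` -/
  compactResolvent : ∃ z : ℝ, ∃ R : H →L[ℂ] H, IsCompactOperator R ∧
    (∀ y : H, ∃ hy : R y ∈ op.domain, op ⟨R y, hy⟩ - (z : ℂ) • R y = y) ∧
    ∀ x : op.domain, R (op x - (z : ℂ) • (x : H)) = x

namespace Hamiltonian

variable (h : Hamiltonian H)

/-- The graph of the `N`-particle Hamiltonian `H_N = ∑_j h_j`: the closure of the graph of `∑_j h_j`
on the linear span of the product vectors with all factors in the domain of `h`. -/
def graph (N : ℕ) : Submodule ℂ (TensorPower H N × TensorPower H N) :=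
  (Submodule.span ℂ (Set.range fun φ : Fin N → h.op.domain =>
    (productVector (fun k => (φ k : H)),
      ∑ j, productVector (Function.update (fun k => (φ k : H)) j (h.op (φ j)))))).topologicalClosure

/-- The energy shell `K_E`: the eigenspace `{x | H_N x = E x}` of `H_N`. -/
def shell (N : ℕ) (E : ℝ) : Submodule ℂ (TensorPower H N) :=
  (h.graph N).comap (LinearMap.prod LinearMap.id ((E : ℂ) • LinearMap.id))

instance completeSpace_shell (N : ℕ) (E : ℝ) : CompleteSpace (h.shell N E) := by
  have hc : IsClosed ((h.shell N E : Submodule ℂ (TensorPower H N)) : Set (TensorPower H N)) := by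
    have h1 : IsClosed (h.graph N : Set (TensorPower H N × TensorPower H N)) :=
      Submodule.isClosed_topologicalClosure _
    have h2 : Continuous fun x : TensorPower H N => (x, (E : ℂ) • x) := by fun_prop
    exact h1.preimage h2
  exact hc.completeSpace_coe

/-- The energy algebra `A_N`: the operators `f(H_N) = ∑_E f(E) P_E` for bounded functions `f` on the
(discrete) spectrum, where `P_E` is the orthogonal projection onto the energy shell `K_E` and the sum
converges strongly. (`P_E = 0` if `E` is not an eigenvalue.) -/
def energyAlgebra (N : ℕ) : Set (TensorPower H N →L[ℂ] TensorPower H N) :=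
  {A | ∃ f : ℝ → ℂ, (∃ M : ℝ, ∀ E, ‖f E‖ ≤ M) ∧
    ∀ x, HasSum (fun E : ℝ => f E • (h.shell N E).starProjection x) (A x)}

end Hamiltonian

end Hamiltonian

section Collisions

section Average

variable {K : Type*} [NormedAddCommGroup K] [InnerProductSpace ℂ K] [CompleteSpace K]

theorem norm_unitary_le {W : K →L[ℂ] K} (hW : W ∈ unitary (K →L[ℂ] K)) : ‖W‖ ≤ 1 := by
  refine ContinuousLinearMap.opNorm_le_bound _ zero_le_one fun x => ?_
  have h1 : star W * W = 1 := Unitary.star_mul_self_of_mem hW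
  have h2 : ‖W x‖ ^ 2 = ‖x‖ ^ 2 := by
    rw [← inner_self_eq_norm_sq (𝕜 := ℂ), ← inner_self_eq_norm_sq (𝕜 := ℂ) x,
      ← ContinuousLinearMap.adjoint_inner_right, ← ContinuousLinearMap.star_eq_adjoint,
      ← mul_apply_eq_comp, h1, one_apply_eq_self]
  rw [one_mul]
  exact (pow_le_pow_iff_left₀ (norm_nonneg _) (norm_nonneg _) two_ne_zero).1 h2.le

theorem continuous_star_unitary {C : Type*} [TopologicalSpace C] (W : C → K →L[ℂ] K)
    (hW : ∀ σ, W σ ∈ unitary (K →L[ℂ] K)) (hc : ∀ x, Continuous fun σ => W σ x) (x : K) :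
    Continuous fun σ => star (W σ) x := by
  rw [continuous_iff_continuousAt]
  intro τ
  have h1 : ∀ σ z, W σ (star (W σ) z) = z := fun σ z => by
    rw [← mul_apply_eq_comp, Unitary.mul_star_self_of_mem (hW σ)]
    rfl
  have h2 : ∀ σ z, star (W σ) (W σ z) = z := fun σ z => by
    rw [← mul_apply_eq_comp, Unitary.star_mul_self_of_mem (hW σ)]
    rfl
  rw [ContinuousAt, tendsto_iff_norm_sub_tendsto_zero]
  have h3 : Tendsto (fun σ => ‖W τ (star (W τ) x) - W σ (star (W τ) x)‖) (𝓝 τ) (𝓝 0) := by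
    have : Continuous fun σ => ‖W τ (star (W τ) x) - W σ (star (W τ) x)‖ :=
      (continuous_const.sub (hc _)).norm
    simpa using this.tendsto τ
  refine squeeze_zero (fun _ => norm_nonneg _) (fun σ => ?_) h3
  have h4 : star (W σ) x - star (W τ) x
      = star (W σ) (W τ (star (W τ) x) - W σ (star (W τ) x)) := by
    rw [map_sub, h1 τ, h2 σ]
  rw [h4]
  exact ContinuousLinearMap.le_of_opNorm_le _ (norm_unitary_le (Unitary.star_mem (hW σ))) _
    |>.trans_eq (one_mul _)

variable {C : Type*} [TopologicalSpace C]

theorem continuous_conj (W : C → K →L[ℂ] K)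
    (hW : ∀ σ, W σ ∈ unitary (K →L[ℂ] K)) (hc : ∀ x, Continuous fun σ => W σ x)
    (A : K →L[ℂ] K) (y : K) :
    Continuous fun σ => W σ (A (star (W σ) y)) := by
  rw [continuous_iff_continuousAt]
  intro τ
  have hz : Continuous fun σ => A (star (W σ) y) :=
    A.continuous.comp (continuous_star_unitary W hW hc y)
  rw [ContinuousAt, tendsto_iff_norm_sub_tendsto_zero]
  have h3 : Tendsto (fun σ => ‖A (star (W σ) y) - A (star (W τ) y)‖
      + ‖W σ (A (star (W τ) y)) - W τ (A (star (W τ) y))‖) (𝓝 τ) (𝓝 0) := by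
    have : Continuous fun σ => ‖A (star (W σ) y) - A (star (W τ) y)‖
      + ‖W σ (A (star (W τ) y)) - W τ (A (star (W τ) y))‖ :=
      (hz.sub continuous_const).norm.add ((hc _).sub continuous_const).norm
    simpa using this.tendsto τ
  refine squeeze_zero (fun _ => norm_nonneg _) (fun σ => ?_) h3
  calc _ = ‖W σ (A (star (W σ) y) - A (star (W τ) y))
        + (W σ (A (star (W τ) y)) - W τ (A (star (W τ) y)))‖ := by
        rw [map_sub]
        congr 1
        abel
    _ ≤ _ := (norm_add_le _ _).trans (by
        gcongr
        exact ((W σ).le_of_opNorm_le (norm_unitary_le (hW σ)) _).trans_eq (one_mul _))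

variable [CompactSpace C] [MeasurableSpace C] [BorelSpace C]

theorem integrable_conj (W : C → K →L[ℂ] K)
    (hW : ∀ σ, W σ ∈ unitary (K →L[ℂ] K)) (hc : ∀ x, Continuous fun σ => W σ x)
    (ν : Measure C) [IsProbabilityMeasure ν]
    (A : K →L[ℂ] K) (y : K) :
    Integrable (fun σ => W σ (A (star (W σ) y))) ν := by
  have h := continuous_conj W hW hc A y
  exact h.integrable_of_hasCompactSupport (HasCompactSupport.of_compactSpace _)

/-- For a strongly continuous family `W` of unitaries, the average
`A ↦ ∫ W(σ) A W(σ)* dν(σ)`, where the integral is taken in the strong sense. -/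
def conjAverage (W : C → K →L[ℂ] K)
    (hW : ∀ σ, W σ ∈ unitary (K →L[ℂ] K)) (hc : ∀ x, Continuous fun σ => W σ x)
    (ν : Measure C) [IsProbabilityMeasure ν] :
    (K →L[ℂ] K) →L[ℂ] (K →L[ℂ] K) :=
  LinearMap.mkContinuous₂
    (LinearMap.mk₂ ℂ (fun (A : K →L[ℂ] K) (y : K) => ∫ σ, W σ (A (star (W σ) y)) ∂ν)
      (fun A B y => by
        rw [← integral_add (integrable_conj W hW hc ν A y) (integrable_conj W hW hc ν B y)]
        simp)
      (fun c A y => by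
        rw [← integral_smul]
        simp)
      (fun A y z => by
        rw [← integral_add (integrable_conj W hW hc ν A y) (integrable_conj W hW hc ν A z)]
        simp)
      (fun c A y => by
        rw [← integral_smul]
        simp)) 1 fun A y => by
    rw [LinearMap.mk₂_apply]
    have h := norm_integral_le_of_norm_le_const (μ := ν) (C := 1 * ‖A‖ * ‖y‖)
      (f := fun σ => W σ (A (star (W σ) y))) (ae_of_all _ fun σ => by
        have h1 := (W σ).le_of_opNorm_le (norm_unitary_le (hW σ)) (A (star (W σ) y))
        have h2 := (star (W σ)).le_of_opNorm_le (norm_unitary_le (Unitary.star_mem (hW σ))) y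
        have h3 := A.le_opNorm (star (W σ) y)
        calc _ ≤ ‖A (star (W σ) y)‖ := by simpa using h1
          _ ≤ ‖A‖ * ‖star (W σ) y‖ := h3
          _ ≤ ‖A‖ * ‖y‖ := by
            gcongr
            simpa using h2
          _ = _ := by ring)
    simpa using h

theorem conjAverage_apply (W : C → K →L[ℂ] K)
    (hW : ∀ σ, W σ ∈ unitary (K →L[ℂ] K)) (hc : ∀ x, Continuous fun σ => W σ x)
    (ν : Measure C) [IsProbabilityMeasure ν]
    (A : K →L[ℂ] K) (y : K) :
    conjAverage W hW hc ν A y = ∫ σ, W σ (A (star (W σ) y)) ∂ν := rfl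

end Average

variable {H : Type*} [NormedAddCommGroup H] [InnerProductSpace ℂ H] [CompleteSpace H]

theorem pairOp_mem_unitary {N : ℕ} (i j : Fin N) (hij : i ≠ j)
    {A : TensorPower H 2 →L[ℂ] TensorPower H 2} (hA : A ∈ unitary _) :
    pairOp i j hij A ∈ unitary (TensorPower H N →L[ℂ] TensorPower H N) := by
  rw [Unitary.mem_iff, pairOp, star_tensorOne, ← tensorOne_mul, ← tensorOne_mul,
    Unitary.star_mul_self_of_mem hA, Unitary.mul_star_self_of_mem hA, tensorOne_one]
  exact ⟨rfl, rfl⟩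

/-- Collision specifications `(C, U, ν)` for the single-particle Hamiltonian `h`, where `C` is a
compact metric space. -/
structure CollisionSpec (h : Hamiltonian H) (C : Type*) [MetricSpace C] [CompactSpace C]
    [MeasurableSpace C] [BorelSpace C] where
  /-- the collision operators, unitaries on `H ⊗ H` -/
  U : C → TensorPower H 2 →L[ℂ] TensorPower H 2
  unitary_U : ∀ σ, U σ ∈ unitary (TensorPower H 2 →L[ℂ] TensorPower H 2)
  /-- `U` is continuous for the strong operator topology (in particular, `U` may be continuous for
  the operator norm) -/
  continuous_U : ∀ x, Continuous fun σ => U σ x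
  injective_U : Function.Injective U
  ν : Measure C
  isProbabilityMeasure_ν : IsProbabilityMeasure ν
  /-- `ν` charges all nonempty open sets -/
  isOpenPosMeasure_ν : ν.IsOpenPosMeasure
  /-- each `U(σ)` commutes with the (unbounded) two-particle Hamiltonian `H_2`, that is,
  `U(σ) H_2 U(σ)* = H_2`, as an identity of graphs -/
  commute_H2 : ∀ σ x y, (U σ x, U σ y) ∈ h.graph 2 ↔ (x, y) ∈ h.graph 2
  exists_trivial : ∃ σ₀, U σ₀ = 1
  /-- time reversal: `U(σ)* = U(σ')`, where `σ ↦ σ'` is measurable and leaves `ν` invariant -/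
  time_reversal : ∃ τ : C → C, MeasurePreserving τ ν ν ∧ ∀ σ, star (U σ) = U (τ σ)
  /-- exchange of the particles: `V U(σ) V* = U(σ')`, where `σ ↦ σ'` is measurable and leaves `ν`
  invariant -/
  exchange : ∃ τ : C → C, MeasurePreserving τ ν ν ∧ ∀ σ, swap * U σ * star swap = U (τ σ)

/-- The semigroup `exp(t L)` generated by a bounded operator `L` on a Banach space. -/
def expSemigroup {B : Type*} [NormedAddCommGroup B] [NormedSpace ℂ B] (L : B →L[ℂ] B) (t : ℝ) :
    B →L[ℂ] B :=
  NormedSpace.exp ((t : ℂ) • L)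

namespace CollisionSpec

variable {h : Hamiltonian H} {C : Type*} [MetricSpace C] [CompactSpace C] [MeasurableSpace C]
  [BorelSpace C] (S : CollisionSpec h C)

/-- Ergodicity: the commutant of the collision operators is the energy algebra `A_2`. -/
def IsErgodic : Prop := Set.centralizer (Set.range S.U) = h.energyAlgebra 2

theorem continuous_pairOp {N : ℕ} (i j : Fin N) (hij : i ≠ j) (x : TensorPower H N) :
    Continuous fun σ => pairOp i j hij (S.U σ) x :=
  continuous_tensorOne _ S.U (fun σ => norm_unitary_le (S.unitary_U σ)) S.continuous_U x

/-- `Q_{i,j} A = ∫ U_{i,j}(σ) A U_{i,j}(σ)* dν(σ)`. -/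
def pairAverage {N : ℕ} (i j : Fin N) (hij : i ≠ j) :
    (TensorPower H N →L[ℂ] TensorPower H N) →L[ℂ] (TensorPower H N →L[ℂ] TensorPower H N) :=
  haveI := S.isProbabilityMeasure_ν
  conjAverage (fun σ => pairOp i j hij (S.U σ))
    (fun σ => pairOp_mem_unitary i j hij (S.unitary_U σ)) (S.continuous_pairOp i j hij) S.ν

theorem pairAverage_apply {N : ℕ} (i j : Fin N) (hij : i ≠ j)
    (A : TensorPower H N →L[ℂ] TensorPower H N) (y : TensorPower H N) :
    S.pairAverage i j hij A y
      = ∫ σ, (pairOp i j hij (S.U σ) * A * star (pairOp i j hij (S.U σ))) y ∂S.ν := rfl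

/-- `Q_N = (N choose 2)⁻¹ ∑_{i<j} Q_{i,j}`. -/
def average (N : ℕ) :
    (TensorPower H N →L[ℂ] TensorPower H N) →L[ℂ] (TensorPower H N →L[ℂ] TensorPower H N) :=
  ((N.choose 2 : ℕ) : ℂ)⁻¹ •
    ∑ p : {p : Fin N × Fin N // p.1 < p.2}, S.pairAverage p.1.1 p.1.2 p.2.ne

/-- The quantum Kac generator `L_N = N (Q_N - 1)`. -/
def generator (N : ℕ) :
    (TensorPower H N →L[ℂ] TensorPower H N) →L[ℂ] (TensorPower H N →L[ℂ] TensorPower H N) :=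
  (N : ℂ) • (S.average N - 1)

/-- The evolution `P_{N,t} = exp(t L_N)` which solves the quantum Kac Master Equation
`dϱ/dt = L_N ϱ`. -/
def evolution (N : ℕ) (t : ℝ) :
    (TensorPower H N →L[ℂ] TensorPower H N) →L[ℂ] (TensorPower H N →L[ℂ] TensorPower H N) :=
  expSemigroup (S.generator N) t

end CollisionSpec

end Collisions

end QuantumKac

end

/-!
Let `ψ` be an orthonormal basis of eigenvectors of `h`. Only finitely many vectors of the product
basis of `H^{⊗N}` have total energy at most `M`, and every collision preserves their span.

Convergence: the operators on such a span form a finite-dimensional space, invariant under the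
contraction `Q_N`, so they lie in `ker (Q_N - 1) + ran (Q_N - 1)`, and every density matrix is a
limit of operators of this kind. On the kernel `exp(t L_N)` is the identity, and on the range it
tends to zero, because neighbouring Poisson weights almost agree; hence `exp(t L_N) ϱ₀` converges in
operator norm. The traces over the invariant spans are conserved, so no mass escapes and the
convergence holds in trace norm.

Equilibria: if `Q_N ϱ = ϱ`, then `ϱ` is an average of its conjugates by the collisions, and by
strict convexity of the Hilbert-Schmidt norm on the invariant spans each conjugate equals `ϱ`.
Therefore `ϱ` commutes with every collision `U_{i,j}(σ)`, and so with the bicommutant of the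
collision operators acting on the factors `i` and `j`. By ergodicity this bicommutant contains the
projection onto every eigenvector `ψ_a ⊗ ψ_b` of `H_2`, so `ϱ` is diagonal in the product basis, and
a diagonal density matrix is a limit of convex combinations of product states.
-/

noncomputable section

namespace QuantumKac

section Poisson

/-- The probability that a Poisson variable of mean `s` equals `k`. -/
def poissonWeight (s : ℝ) (k : ℕ) : ℝ :=
  Real.exp (-s) * (s ^ k / k.factorial)

theorem poissonWeight_nonneg {s : ℝ} (hs : 0 ≤ s) (k : ℕ) : 0 ≤ poissonWeight s k := by
  unfold poissonWeight
  positivity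

theorem succ_mul_poissonWeight_succ (s : ℝ) (k : ℕ) :
    (k + 1) * poissonWeight s (k + 1) = s * poissonWeight s k := by
  simp only [poissonWeight, Nat.factorial_succ, pow_succ]
  push_cast
  field_simp

theorem hasSum_poissonWeight (s : ℝ) : HasSum (poissonWeight s) 1 := by
  have h := (NormedSpace.expSeries_div_hasSum_exp s).mul_left (Real.exp (-s))
  rwa [← Real.exp_eq_exp_ℝ, ← Real.exp_add, neg_add_cancel, Real.exp_zero] at h

theorem hasSum_mul_poissonWeight (s : ℝ) : HasSum (fun k : ℕ => k * poissonWeight s k) s := by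
  rw [← hasSum_nat_add_iff' 1]
  simpa [succ_mul_poissonWeight_succ] using (hasSum_poissonWeight s).mul_left s

theorem hasSum_sq_mul_poissonWeight (s : ℝ) :
    HasSum (fun k : ℕ => (k : ℝ) ^ 2 * poissonWeight s k) (s ^ 2 + s) := by
  have hsucc (k : ℕ) : ((k : ℝ) + 1) ^ 2 * poissonWeight s (k + 1)
      = s * (k * poissonWeight s k) + s * poissonWeight s k := by
    rw [pow_two, mul_assoc, succ_mul_poissonWeight_succ]
    ring
  rw [← hasSum_nat_add_iff' 1]
  simpa [hsucc, ← pow_two] using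
    ((hasSum_mul_poissonWeight s).mul_left s).add ((hasSum_poissonWeight s).mul_left s)

theorem hasSum_sq_div_sub_one_mul_poissonWeight {s : ℝ} (hs : s ≠ 0) :
    HasSum (fun k : ℕ => (k / s - 1) ^ 2 * poissonWeight s k) s⁻¹ := by
  have h := (((hasSum_sq_mul_poissonWeight s).mul_left (s⁻¹ ^ 2)).sub
    ((hasSum_mul_poissonWeight s).mul_left (2 * s⁻¹))).add (hasSum_poissonWeight s)
  have hvalue : s⁻¹ ^ 2 * (s ^ 2 + s) - 2 * s⁻¹ * s + 1 = s⁻¹ := by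
    field_simp
    ring
  rw [hvalue] at h
  refine h.congr_fun fun k => ?_
  field_simp
  ring

end Poisson

section Semigroup

variable {B : Type*} [NormedAddCommGroup B] [NormedSpace ℂ B] {Q : B →L[ℂ] B} {x : B} {s : ℝ}

theorem norm_pow_apply_le (hQ : ‖Q‖ ≤ 1) (k : ℕ) (x : B) : ‖(Q ^ k) x‖ ≤ ‖x‖ := by
  induction k with
  | zero => rfl
  | succ k ih =>
    rw [pow_succ']
    exact (Q.le_of_opNorm_le hQ _).trans (by rwa [one_mul])

theorem pow_apply_add_of_apply_eq {z : B} (hx : Q x = x + z) (hz : Q z = z) (n : ℕ) :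
    (Q ^ n) x = x + n • z := by
  induction n with
  | zero => simp
  | succ n ih => rw [pow_succ', mul_apply_eq_comp, ih, map_add, map_nsmul, hx, hz]; module

theorem disjoint_ker_range_sub_one (hQ : ‖Q‖ ≤ 1) :
    Disjoint (Q - 1).ker (Q - 1).range := by
  rw [Submodule.disjoint_def]
  rintro z hz ⟨x, rfl⟩
  set z := (Q - 1) x
  -- Otherwise `Qⁿ x = x + n z` would be unbounded.
  have hbound (n : ℕ) : n * ‖z‖ ≤ 2 * ‖x‖ := by
    have hpow := pow_apply_add_of_apply_eq (x := x) (z := z) (by simp [z])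
      (sub_eq_zero.1 (LinearMap.mem_ker.1 hz)) n
    calc n * ‖z‖ = ‖(Q ^ n) x - x‖ := by
          rw [hpow, add_sub_cancel_left, ← Nat.cast_smul_eq_nsmul ℝ, norm_smul, Real.norm_natCast]
      _ ≤ ‖(Q ^ n) x‖ + ‖x‖ := norm_sub_le _ _
      _ ≤ 2 * ‖x‖ := by linarith [norm_pow_apply_le hQ n x]
  by_contra hne
  obtain ⟨n, hn⟩ := exists_lt_nsmul (norm_pos_iff.2 hne) (2 * ‖x‖)
  exact (hbound n).not_gt (by rwa [nsmul_eq_mul] at hn)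

theorem mem_ker_sup_range_of_finiteDimensional (hQ : ‖Q‖ ≤ 1) {V : Submodule ℂ B}
    [FiniteDimensional ℂ V] (hV : ∀ x ∈ V, Q x ∈ V) (hx : x ∈ V) :
    x ∈ (Q - 1).ker ⊔ (Q - 1).range := by
  let q : V →ₗ[ℂ] V := (Q : B →ₗ[ℂ] B).restrict hV - 1
  have hker : q.ker.map V.subtype ≤ (Q - 1).ker := by
    rintro _ ⟨v, hv, rfl⟩
    exact congrArg Subtype.val (LinearMap.mem_ker.1 hv)
  have hrange : q.range.map V.subtype ≤ (Q - 1).range := by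
    rintro _ ⟨_, ⟨v, rfl⟩, rfl⟩
    exact ⟨v, rfl⟩
  have hdisj : Disjoint q.ker q.range := Submodule.disjoint_def.2 fun v hv hv' =>
    Subtype.ext (Submodule.disjoint_def.1 (disjoint_ker_range_sub_one hQ) v
      (hker (Submodule.mem_map_of_mem hv)) (hrange (Submodule.mem_map_of_mem hv')))
  have htop : q.ker ⊔ q.range = ⊤ :=
    Submodule.eq_top_of_disjoint _ _ (by rw [add_comm, q.finrank_range_add_finrank_ker]) hdisj
  have hmap := sup_le_sup hker hrange
  rw [← Submodule.map_sup, htop, Submodule.map_subtype_top] at hmap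
  exact hmap hx

variable [CompleteSpace B]

theorem expSemigroup_sub_one (Q : B →L[ℂ] B) (s : ℝ) :
    expSemigroup (Q - 1) s = Real.exp (-s) • NormedSpace.exp ((s : ℂ) • Q) := by
  have hcomm : Commute ((s : ℂ) • Q) (algebraMap ℂ (B →L[ℂ] B) (-s)) :=
    (Algebra.commutes _ _).symm
  let _ : NormedAlgebra ℚ (B →L[ℂ] B) := NormedAlgebra.restrictScalars ℚ ℂ _
  rw [expSemigroup, smul_sub, sub_eq_add_neg, ← neg_smul, ← Algebra.algebraMap_eq_smul_one,
    NormedSpace.exp_add_of_commute hcomm, ← NormedSpace.algebraMap_exp_comm,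
    ← Complex.exp_eq_exp_ℂ, ← Algebra.commutes, ← Algebra.smul_def, ← Complex.coe_smul,
    Complex.ofReal_exp, Complex.ofReal_neg]

theorem hasSum_expSemigroup_apply (Q : B →L[ℂ] B) (s : ℝ) (x : B) :
    HasSum (fun k : ℕ => poissonWeight s k • (Q ^ k) x) (expSemigroup (Q - 1) s x) := by
  rw [expSemigroup_sub_one]
  convert (ContinuousLinearMap.apply ℂ B x).hasSum
    ((NormedSpace.exp_series_hasSum_exp' (𝕂 := ℂ) ((s : ℂ) • Q)).const_smul (Real.exp (-s)))
    using 1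
  · ext k
    rw [ContinuousLinearMap.apply_apply, smul_pow, smul_smul, ← Complex.ofReal_pow,
      ← Complex.ofReal_natCast, ← Complex.ofReal_inv, ← Complex.ofReal_mul, Complex.coe_smul,
      smul_smul, poissonWeight, inv_mul_eq_div]
    rfl
  · rfl

theorem norm_expSemigroup_apply_le (hQ : ‖Q‖ ≤ 1) (hs : 0 ≤ s) (x : B) :
    ‖expSemigroup (Q - 1) s x‖ ≤ ‖x‖ := by
  have hbound := (hasSum_poissonWeight s).mul_right ‖x‖
  rw [one_mul] at hbound
  rw [← (hasSum_expSemigroup_apply Q s x).tsum_eq]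
  refine tsum_of_norm_bounded hbound fun k => ?_
  rw [norm_smul, Real.norm_of_nonneg (poissonWeight_nonneg hs k)]
  exact mul_le_mul_of_nonneg_left (norm_pow_apply_le hQ k x) (poissonWeight_nonneg hs k)

theorem map_expSemigroup_apply {E : Type*} [NormedAddCommGroup E] [NormedSpace ℂ E]
    (φ : B →L[ℂ] E) (hφ : ∀ x, φ (Q x) = φ x) (s : ℝ) (x : B) :
    φ (expSemigroup (Q - 1) s x) = φ x := by
  have hpow (k : ℕ) : φ ((Q ^ k) x) = φ x := by
    induction k with
    | zero => rfl
    | succ k ih => rw [pow_succ', mul_apply_eq_comp, hφ, ih]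
  refine (φ.hasSum (hasSum_expSemigroup_apply Q s x)).unique ?_
  simpa only [φ.map_smul_of_tower, hpow, one_smul] using
    (hasSum_poissonWeight s).smul_const (φ x)

theorem expSemigroup_apply_of_fixed (hx : Q x = x) (s : ℝ) : expSemigroup (Q - 1) s x = x := by
  refine (hasSum_expSemigroup_apply Q s x).unique ?_
  simpa [Function.iterate_fixed hx] using (hasSum_poissonWeight s).smul_const x

theorem expSemigroup_apply_nonneg [PartialOrder B] [IsOrderedAddMonoid B]
    [OrderClosedTopology B] [PosSMulMono ℝ B] (hQ : ∀ x, 0 ≤ x → 0 ≤ Q x) (hs : 0 ≤ s)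
    (hx : 0 ≤ x) : 0 ≤ expSemigroup (Q - 1) s x := by
  have hpow (k : ℕ) : 0 ≤ (Q ^ k) x := by
    induction k with
    | zero => exact hx
    | succ k ih =>
      rw [pow_succ']
      exact hQ _ ih
  exact (hasSum_expSemigroup_apply Q s x).nonneg fun k =>
    smul_nonneg (poissonWeight_nonneg hs k) (hpow k)

theorem hasSum_expSemigroup_apply_sub (hs : s ≠ 0) (x : B) :
    HasSum (fun k : ℕ => ((k / s - 1) * poissonWeight s k) • (Q ^ k) x)
      (expSemigroup (Q - 1) s (Q x - x)) := by
  have hshift : HasSum (fun k : ℕ => (k / s * poissonWeight s k) • (Q ^ k) x)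
      (expSemigroup (Q - 1) s (Q x)) := by
    rw [← hasSum_nat_add_iff' 1]
    convert hasSum_expSemigroup_apply Q s (Q x) using 2 with k
    · rw [div_mul_eq_mul_div, Nat.cast_succ, succ_mul_poissonWeight_succ,
        mul_div_cancel_left₀ _ hs, pow_succ]
      rfl
    · simp
  rw [map_sub]
  refine (hshift.sub (hasSum_expSemigroup_apply Q s x)).congr_fun fun k => ?_
  rw [sub_mul, one_mul, sub_smul]

theorem norm_expSemigroup_apply_sub_le (hQ : ‖Q‖ ≤ 1) (hs : 0 < s) (x : B) :
    ‖expSemigroup (Q - 1) s (Q x - x)‖ ≤ (√s)⁻¹ * ‖x‖ := by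
  have : 0 < √s := Real.sqrt_pos.2 hs
  -- AM-GM: the mean deviation is at most the root of the variance.
  have hamgm (d : ℝ) : |d| ≤ (√s)⁻¹ / 2 + √s / 2 * d ^ 2 := by
    have hsq : 0 ≤ (√s)⁻¹ / 2 * (1 - √s * |d|) ^ 2 := by positivity
    have hexpand : (√s)⁻¹ / 2 * (1 - √s * |d|) ^ 2 = (√s)⁻¹ / 2 + √s / 2 * d ^ 2 - |d| := by
      rw [← sq_abs d]
      field_simp
      ring
    linarith
  have hbound : HasSum (fun k : ℕ => ((√s)⁻¹ / 2 * poissonWeight s k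
      + √s / 2 * ((k / s - 1) ^ 2 * poissonWeight s k)) * ‖x‖) ((√s)⁻¹ * ‖x‖) := by
    have hvalue : (√s)⁻¹ / 2 * 1 + √s / 2 * s⁻¹ = (√s)⁻¹ := by
      nth_rewrite 3 [← Real.mul_self_sqrt hs.le]
      field_simp
      norm_num
    have h := (((hasSum_poissonWeight s).mul_left ((√s)⁻¹ / 2)).add
      ((hasSum_sq_div_sub_one_mul_poissonWeight hs.ne').mul_left (√s / 2))).mul_right ‖x‖
    rwa [hvalue] at h
  rw [← (hasSum_expSemigroup_apply_sub hs.ne' x).tsum_eq]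
  refine tsum_of_norm_bounded hbound fun k => ?_
  rw [norm_smul, Real.norm_eq_abs, abs_mul, abs_of_nonneg (poissonWeight_nonneg hs.le k),
    ← mul_assoc, ← add_mul]
  have hw := poissonWeight_nonneg hs.le k
  gcongr
  · exact hamgm _
  · exact norm_pow_apply_le hQ k x

theorem tendsto_expSemigroup_apply_sub (hQ : ‖Q‖ ≤ 1) (x : B) :
    Tendsto (fun s : ℝ => expSemigroup (Q - 1) s (Q x - x)) atTop (𝓝 0) := by
  have hzero : Tendsto (fun s : ℝ => (√s)⁻¹ * ‖x‖) atTop (𝓝 0) := by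
    simpa using (tendsto_inv_atTop_zero.comp Real.tendsto_sqrt_atTop).mul_const ‖x‖
  refine squeeze_zero_norm' ?_ hzero
  filter_upwards [eventually_gt_atTop 0] with s hs using norm_expSemigroup_apply_sub_le hQ hs x

theorem tendsto_expSemigroup_apply_add (hQ : ‖Q‖ ≤ 1) {x₀ : B} (hx₀ : Q x₀ = x₀) (y : B) :
    Tendsto (fun s : ℝ => expSemigroup (Q - 1) s (x₀ + (Q y - y))) atTop (𝓝 x₀) := by
  simpa [expSemigroup_apply_of_fixed hx₀] using
    (tendsto_expSemigroup_apply_sub hQ y).const_add x₀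

theorem apply_eq_of_tendsto_expSemigroup (hQ : ‖Q‖ ≤ 1) {z : B}
    (hz : Tendsto (fun s : ℝ => expSemigroup (Q - 1) s x) atTop (𝓝 z)) : Q z = z := by
  have hcomm (s : ℝ) : (Q - 1) (expSemigroup (Q - 1) s x) = expSemigroup (Q - 1) s (Q x - x) :=
    congrArg (fun T : B →L[ℂ] B => T x)
      ((Commute.refl (Q - 1)).smul_right (s : ℂ)).exp_right.eq
  have hlim := ((Q - 1).continuous.tendsto z).comp hz
  simp only [Function.comp_def, hcomm] at hlim
  simpa [sub_eq_zero] using tendsto_nhds_unique hlim (tendsto_expSemigroup_apply_sub hQ x)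

theorem exists_tendsto_expSemigroup (hQ : ‖Q‖ ≤ 1)
    (hx : x ∈ ((Q - 1).ker ⊔ (Q - 1).range).topologicalClosure) :
    ∃ z : B, Q z = z ∧ Tendsto (fun s : ℝ => expSemigroup (Q - 1) s x) atTop (𝓝 z) := by
  suffices CauchySeq fun s : ℝ => expSemigroup (Q - 1) s x by
    obtain ⟨z, hz⟩ := cauchySeq_tendsto_of_complete this
    exact ⟨z, apply_eq_of_tendsto_expSemigroup hQ hz, hz⟩
  rw [Metric.cauchySeq_iff']
  intro ε hε
  obtain ⟨y, hy, hxy⟩ := Metric.mem_closure_iff.1 hx (ε / 4) (by positivity)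
  obtain ⟨x₀, hx₀, _, ⟨w, rfl⟩, rfl⟩ := Submodule.mem_sup.1 hy
  have hlim := tendsto_expSemigroup_apply_add hQ (sub_eq_zero.1 (LinearMap.mem_ker.1 hx₀)) w
  have hnear : ∀ᶠ s : ℝ in atTop, dist (expSemigroup (Q - 1) s x) x₀ < ε / 2 := by
    filter_upwards [eventually_ge_atTop 0,
      hlim.eventually (Metric.ball_mem_nhds x₀ (show 0 < ε / 4 by positivity))] with s hs hball
    have hcontr := norm_expSemigroup_apply_le hQ hs (x - (x₀ + (Q w - w)))
    rw [map_sub, ← dist_eq_norm, ← dist_eq_norm] at hcontr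
    linarith [dist_triangle (expSemigroup (Q - 1) s x) (expSemigroup (Q - 1) s (x₀ + (Q w - w))) x₀,
      Metric.mem_ball.1 hball, show dist x (x₀ + (Q w - w)) < ε / 4 from hxy]
  obtain ⟨s₀, hs₀⟩ := hnear.exists_forall_of_atTop
  exact ⟨s₀, fun s hs => by
    linarith [dist_triangle_right (expSemigroup (Q - 1) s x) (expSemigroup (Q - 1) s₀ x) x₀,
      hs₀ s hs, hs₀ s₀ le_rfl]⟩

end Semigroup

section BasisProj

variable {K : Type*} [NormedAddCommGroup K] [InnerProductSpace ℂ K] {ι : Type*}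
  (b : HilbertBasis ι ℂ K) {F : Finset ι} {A B : K →L[ℂ] K}

theorem ext_hilbertBasis {E : Type*} [NormedAddCommGroup E] [NormedSpace ℂ E] {A B : K →L[ℂ] E}
    (h : ∀ i, A (b i) = B (b i)) : A = B :=
  ContinuousLinearMap.ext_on (Submodule.dense_iff_topologicalClosure_eq_top.2 b.dense_span)
    (Set.forall_mem_range.2 h)

theorem ext_inner_hilbertBasis {x y : K} (h : ∀ i, ⟪b i, x⟫_ℂ = ⟪b i, y⟫_ℂ) : x = y :=
  b.repr.injective (lp.ext (funext fun i => by simpa only [b.repr_apply_apply] using h i))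

theorem inner_hilbertBasis [DecidableEq ι] (i j : ι) : ⟪b i, b j⟫_ℂ = if i = j then 1 else 0 :=
  orthonormal_iff_ite.1 b.orthonormal i j

variable (F)

/-- The orthogonal projection onto the span of finitely many vectors of a Hilbert basis. -/
def basisProj : K →L[ℂ] K := ∑ i ∈ F, InnerProductSpace.rankOne ℂ (b i) (b i)

theorem basisProj_apply (x : K) : basisProj b F x = ∑ i ∈ F, ⟪b i, x⟫_ℂ • b i := by
  simp only [basisProj, sum_apply, InnerProductSpace.rankOne_apply]

variable {F}

theorem basisProj_basis_of_mem {i : ι} (hi : i ∈ F) : basisProj b F (b i) = b i := by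
  classical
  simp [basisProj_apply, inner_hilbertBasis, hi]

theorem basisProj_basis_of_notMem {i : ι} (hi : i ∉ F) : basisProj b F (b i) = 0 := by
  classical
  simp [basisProj_apply, inner_hilbertBasis, hi]

variable (F)

theorem isSelfAdjoint_basisProj [CompleteSpace K] : IsSelfAdjoint (basisProj b F) :=
  isSelfAdjoint_sum _ fun i _ => (InnerProductSpace.isPositive_rankOne_self (b i)).isSelfAdjoint

theorem inner_basisProj_left [CompleteSpace K] (x y : K) :
    ⟪basisProj b F x, y⟫_ℂ = ⟪x, basisProj b F y⟫_ℂ :=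
  (isSelfAdjoint_basisProj b F).isSymmetric x y

variable {F}

theorem commute_basisProj [CompleteSpace K] (h₁ : ∀ i ∈ F, ∀ j ∉ F, ⟪b i, A (b j)⟫_ℂ = 0)
    (h₂ : ∀ i ∉ F, ∀ j ∈ F, ⟪b i, A (b j)⟫_ℂ = 0) : Commute A (basisProj b F) := by
  refine ext_hilbertBasis b fun j => ext_inner_hilbertBasis b fun i => ?_
  rw [mul_apply_eq_comp, mul_apply_eq_comp, ← inner_basisProj_left]
  by_cases hi : i ∈ F <;> by_cases hj : j ∈ F <;>
    simp [basisProj_basis_of_mem, basisProj_basis_of_notMem, *]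

variable (F)

/-- The trace of the compression of an operator to the span of finitely many basis vectors. -/
def basisTrace : (K →L[ℂ] K) →L[ℂ] ℂ :=
  ∑ i ∈ F, (innerSL ℂ (b i)).comp (ContinuousLinearMap.apply ℂ K (b i))

theorem basisTrace_apply (A : K →L[ℂ] K) : basisTrace b F A = ∑ i ∈ F, ⟪b i, A (b i)⟫_ℂ := by
  simp [basisTrace]

theorem basisTrace_mul_basisProj_mul (A B : K →L[ℂ] K) :
    basisTrace b F (A * basisProj b F * B) = basisTrace b F (B * basisProj b F * A) := by
  simp only [basisTrace_apply, mul_apply_eq_comp, basisProj_apply, map_sum, map_smul, inner_sum,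
    inner_smul_right]
  rw [Finset.sum_comm]
  simp only [mul_comm]

variable {F}

theorem basisTrace_mul_comm [CompleteSpace K] (hB : Commute B (basisProj b F)) :
    basisTrace b F (A * B) = basisTrace b F (B * A) := by
  have hright (T : K →L[ℂ] K) : basisTrace b F (T * basisProj b F) = basisTrace b F T := by
    simp only [basisTrace_apply]
    refine Finset.sum_congr rfl fun i hi => ?_
    rw [mul_apply_eq_comp, basisProj_basis_of_mem b hi]
  have hleft (T : K →L[ℂ] K) : basisTrace b F (basisProj b F * T) = basisTrace b F T := by
    simp only [basisTrace_apply]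
    refine Finset.sum_congr rfl fun i hi => ?_
    rw [mul_apply_eq_comp, ← inner_basisProj_left, basisProj_basis_of_mem b hi]
  calc basisTrace b F (A * B) = basisTrace b F (A * basisProj b F * B) := by
        rw [← hright, mul_assoc, hB.eq, mul_assoc]
    _ = basisTrace b F (B * basisProj b F * A) := basisTrace_mul_basisProj_mul b F A B
    _ = basisTrace b F (B * A) := by rw [hB.eq, mul_assoc, hleft]

theorem basisTrace_conj [CompleteSpace K] {W : K →L[ℂ] K} (hW : W ∈ unitary (K →L[ℂ] K))
    (hc : Commute W (basisProj b F)) (A : K →L[ℂ] K) :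
    basisTrace b F (W * A * star W) = basisTrace b F A := by
  rw [mul_assoc, ← basisTrace_mul_comm b hc, mul_assoc, Unitary.star_mul_self_of_mem hW, mul_one]

end BasisProj

section TraceNorm

variable {K : Type*} [NormedAddCommGroup K] [InnerProductSpace ℂ K] {A B G : K →L[ℂ] K}

theorem re_inner_le_re_inner (h : A ≤ B) (v : K) :
    RCLike.re ⟪v, A v⟫_ℂ ≤ RCLike.re ⟪v, B v⟫_ℂ := by
  simpa [inner_sub_right] using (ContinuousLinearMap.le_def _ _).1 h |>.re_inner_nonneg_right v

theorem re_inner_nonneg (hA : 0 ≤ A) (v : K) : 0 ≤ RCLike.re ⟪v, A v⟫_ℂ :=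
  ((ContinuousLinearMap.nonneg_iff_isPositive A).1 hA).re_inner_nonneg_right v

theorem mem_orthogonal_of_inner_hilbertBasis {M : Submodule ℂ K} [CompleteSpace M] {ι : Type*}
    (b : HilbertBasis ι ℂ M) {x : K} (h : ∀ i, ⟪(b i : K), x⟫_ℂ = 0) : x ∈ Mᗮ := by
  rw [← Submodule.orthogonalProjectionOnto_eq_zero_iff]
  refine ext_inner_hilbertBasis b fun i => ?_
  rw [Submodule.inner_orthogonalProjectionOnto_eq_of_mem_left, inner_zero_right, h]

variable [CompleteSpace K]

theorem exists_hilbertBasis_mem_or_mem_orthogonal (M : Submodule ℂ K) [CompleteSpace M] :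
    ∃ (w : Set K) (b : HilbertBasis w ℂ K), ∀ i, b i ∈ M ∨ b i ∈ Mᗮ := by
  have hv : Orthonormal ℂ fun i => (onb M i : K) :=
    (onb M).orthonormal.comp_linearIsometry M.subtypeₗᵢ
  obtain ⟨w, b, hw, hb⟩ := hv.toSubtypeRange.exists_hilbertBasis_extension
  refine ⟨w, b, fun i => or_iff_not_imp_left.2 fun hi => ?_⟩
  refine mem_orthogonal_of_inner_hilbertBasis (onb M) fun j => ?_
  have hj : (onb M j : K) = b ⟨onb M j, hw ⟨j, rfl⟩⟩ := by rw [hb]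
  rw [hj]
  refine b.orthonormal.2 fun h => hi ?_
  rw [← h, ← hj]
  exact (onb M j).2

-- `|A|` is `-A` on the kernel of `A⁺` and `A` on its orthogonal complement, so the traces are
-- compared in a Hilbert basis adapted to this decomposition.
theorem traceNorm_le_posTrace (h₁ : -G ≤ A) (h₂ : A ≤ G) : traceNorm A ≤ posTrace G := by
  have hG : 0 ≤ G := by
    have h : G = (1 / 2 : ℝ) • ((A - -G) + (G - A)) := by module
    rw [h]
    exact smul_nonneg (by norm_num) (add_nonneg (sub_nonneg.2 h₁) (sub_nonneg.2 h₂))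
  have hA : IsSelfAdjoint A := by
    simpa using hG.isSelfAdjoint.sub (sub_nonneg.2 h₂).isSelfAdjoint
  have hsub (v : K) : A v = A⁺ v - A⁻ v := by rw [← sub_apply, CFC.posPart_sub_negPart A hA]
  have habs (v : K) : CFC.abs A v = A⁺ v + A⁻ v := by
    rw [← add_apply, CFC.posPart_add_negPart A hA]
  let M : Submodule ℂ K := (A⁺ : K →L[ℂ] K).ker
  have : CompleteSpace M := (ContinuousLinearMap.isClosed_ker A⁺).completeSpace_coe
  obtain ⟨ι, b, hb⟩ := exists_hilbertBasis_mem_or_mem_orthogonal M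
  rw [traceNorm, posTrace_eq b ((ContinuousLinearMap.nonneg_iff_isPositive _).1 (CFC.abs_nonneg A)),
    posTrace_eq b ((ContinuousLinearMap.nonneg_iff_isPositive _).1 hG)]
  refine ENNReal.tsum_le_tsum fun i => ENNReal.ofReal_le_ofReal ?_
  rcases hb i with hi | hi
  · have hpos : A⁺ (b i) = 0 := hi
    have hneg : CFC.abs A (b i) = (-A) (b i) := by
      rw [neg_apply, habs, hsub, hpos, zero_add, zero_sub, neg_neg]
    rw [hneg]
    exact re_inner_le_re_inner (neg_le.1 h₁) _
  · have hneg : A⁻ (b i) = 0 := by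
      refine ext_inner_left ℂ fun x => ?_
      have hx : A⁻ x ∈ M := congrArg (fun T : K →L[ℂ] K => T x) (CFC.posPart_mul_negPart A)
      rw [inner_zero_right, ← Submodule.inner_right_of_mem_orthogonal hx hi]
      exact ((CFC.negPart_nonneg A).isSelfAdjoint.isSymmetric x (b i)).symm
    have hpos : CFC.abs A (b i) = A (b i) := by
      rw [habs, hsub, hneg, add_zero, sub_zero]
    rw [hpos]
    exact re_inner_le_re_inner h₂ _

theorem traceNorm_sub_comm (A B : K →L[ℂ] K) : traceNorm (A - B) = traceNorm (B - A) := by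
  rw [traceNorm, ← CFC.abs_neg, neg_sub, traceNorm]

theorem posTrace_eq_tsum {ι : Type*} (b : HilbertBasis ι ℂ K) (hA : 0 ≤ A) :
    posTrace A = ∑' i, ENNReal.ofReal (RCLike.re ⟪b i, A (b i)⟫_ℂ) :=
  posTrace_eq b ((ContinuousLinearMap.nonneg_iff_isPositive A).1 hA)

theorem posTrace_add (hA : 0 ≤ A) (hB : 0 ≤ B) : posTrace (A + B) = posTrace A + posTrace B := by
  simp only [posTrace, add_apply, inner_add_right, map_add]
  simp_rw [ENNReal.ofReal_add (re_inner_nonneg hA _) (re_inner_nonneg hB _), ENNReal.tsum_add]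

theorem posTrace_smul {c : ℝ} (hc : 0 ≤ c) (A : K →L[ℂ] K) :
    posTrace (c • A) = ENNReal.ofReal c * posTrace A := by
  have h (z : ℂ) : RCLike.re ((c : ℂ) * z) = c * RCLike.re z := Complex.re_ofReal_mul c z
  simp only [posTrace, ← Complex.coe_smul c A, smul_apply, inner_smul_right, h,
    ENNReal.ofReal_mul hc, ENNReal.tsum_mul_left]

theorem le_abs_of_isSelfAdjoint (hA : IsSelfAdjoint A) : A ≤ CFC.abs A := by
  rw [← CFC.posPart_add_negPart A hA]
  exact (CFC.le_posPart hA).trans (le_add_of_nonneg_right (CFC.negPart_nonneg A))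

theorem neg_abs_le_of_isSelfAdjoint (hA : IsSelfAdjoint A) : -CFC.abs A ≤ A := by
  rw [neg_le, ← CFC.abs_neg]
  exact le_abs_of_isSelfAdjoint hA.neg

theorem traceNorm_add_le (hA : IsSelfAdjoint A) (hB : IsSelfAdjoint B) :
    traceNorm (A + B) ≤ traceNorm A + traceNorm B := by
  refine (traceNorm_le_posTrace (G := CFC.abs A + CFC.abs B) ?_ ?_).trans_eq
    (posTrace_add (CFC.abs_nonneg A) (CFC.abs_nonneg B))
  · rw [neg_add]
    exact add_le_add (neg_abs_le_of_isSelfAdjoint hA) (neg_abs_le_of_isSelfAdjoint hB)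
  · exact add_le_add (le_abs_of_isSelfAdjoint hA) (le_abs_of_isSelfAdjoint hB)

-- `‖S x‖² = ∑ |⟪S b_i, x⟫|² ≤ ‖x‖² ∑ ‖S b_i‖²` for the square root `S` of `A`.
theorem norm_le_posTrace (hA : 0 ≤ A) : ENNReal.ofReal ‖A‖ ≤ posTrace A := by
  let S := CFC.sqrt A
  have hS : IsSelfAdjoint S := (CFC.sqrt_nonneg A).isSelfAdjoint
  have hSA : S * S = A := CFC.sqrt_mul_sqrt_self A
  have hadj (x y : K) : ⟪S x, y⟫_ℂ = ⟪x, S y⟫_ℂ := hS.isSymmetric x y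
  have hsq (x : K) : RCLike.re ⟪x, A x⟫_ℂ = ‖S x‖ ^ 2 := by
    rw [← hSA, mul_apply_eq_comp, ← hadj, inner_self_eq_norm_sq]
  rcases eq_or_ne (posTrace A) ⊤ with htop | htop
  · simp [htop]
  have hbound (x : K) : ‖S x‖ ^ 2 ≤ (posTrace A).toReal * ‖x‖ ^ 2 := by
    rw [← ENNReal.ofReal_le_ofReal_iff (by positivity), ENNReal.ofReal_mul ENNReal.toReal_nonneg,
      ENNReal.ofReal_toReal htop, ← tsum_ofReal_norm_inner_sq (onb K) (S x), posTrace,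
      ← ENNReal.tsum_mul_right]
    refine ENNReal.tsum_le_tsum fun i => ?_
    rw [hsq, ← ENNReal.ofReal_mul (by positivity), ← mul_pow, ← hadj]
    exact ENNReal.ofReal_le_ofReal (by gcongr; exact norm_inner_le_norm _ _)
  have hS' : ‖S‖ ≤ √(posTrace A).toReal := S.opNorm_le_bound (Real.sqrt_nonneg _) fun x => by
    rw [← Real.sqrt_sq (norm_nonneg x), ← Real.sqrt_mul ENNReal.toReal_nonneg]
    exact Real.le_sqrt_of_sq_le (hbound x)
  refine ENNReal.ofReal_le_of_le_toReal ?_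
  calc ‖A‖ = ‖S‖ ^ 2 := by rw [← hSA, hS.norm_mul_self]
    _ ≤ √(posTrace A).toReal ^ 2 := by gcongr
    _ = (posTrace A).toReal := Real.sq_sqrt ENNReal.toReal_nonneg

theorem norm_le_traceNorm (A : K →L[ℂ] K) : ENNReal.ofReal ‖A‖ ≤ traceNorm A := by
  rw [← CFC.norm_abs]
  exact norm_le_posTrace (CFC.abs_nonneg A)

end TraceNorm

section Compression

variable {K : Type*} [NormedAddCommGroup K] [InnerProductSpace ℂ K] {A X : K →L[ℂ] K}
  {ι : Type*} (b : HilbertBasis ι ℂ K) (F : Finset ι)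

/-- The compression `P A P` of an operator to the span of finitely many basis vectors. -/
def compression (A : K →L[ℂ] K) : K →L[ℂ] K := basisProj b F * A * basisProj b F

variable {F} in
theorem compression_basis_of_notMem {i : ι} (hi : i ∉ F) : compression b F A (b i) = 0 := by
  rw [compression, mul_apply_eq_comp, basisProj_basis_of_notMem b hi, map_zero]

theorem compression_sub (A B : K →L[ℂ] K) :
    compression b F (A - B) = compression b F A - compression b F B := by
  simp only [compression, mul_sub, sub_mul]

theorem ofReal_re_basisTrace (hA : 0 ≤ A) : ENNReal.ofReal (RCLike.re (basisTrace b F A)) =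
    ∑ i ∈ F, ENNReal.ofReal (RCLike.re ⟪b i, A (b i)⟫_ℂ) := by
  rw [basisTrace_apply, map_sum, ENNReal.ofReal_sum_of_nonneg fun i _ => re_inner_nonneg hA _]

variable [CompleteSpace K]

theorem compression_nonneg (hA : 0 ≤ A) : 0 ≤ compression b F A :=
  (isSelfAdjoint_basisProj b F).conjugate_nonneg hA

theorem isSelfAdjoint_compression (hA : IsSelfAdjoint A) : IsSelfAdjoint (compression b F A) :=
  hA.conjugate_self (isSelfAdjoint_basisProj b F)

variable {F}

theorem inner_compression_of_mem {i j : ι} (hi : i ∈ F) (hj : j ∈ F) :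
    ⟪b i, compression b F A (b j)⟫_ℂ = ⟪b i, A (b j)⟫_ℂ := by
  rw [compression, mul_apply_eq_comp, mul_apply_eq_comp, ← inner_basisProj_left,
    basisProj_basis_of_mem b hi, basisProj_basis_of_mem b hj]

variable (F)

theorem posTrace_compression (hA : 0 ≤ A) :
    posTrace (compression b F A) = ENNReal.ofReal (RCLike.re (basisTrace b F A)) := by
  rw [posTrace_eq_tsum b (compression_nonneg b F hA), ofReal_re_basisTrace b F hA,
    tsum_eq_sum (s := F) fun i hi => by simp [compression_basis_of_notMem b hi]]
  exact Finset.sum_congr rfl fun i hi => by rw [inner_compression_of_mem b hi hi]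

theorem posTrace_eq_compression_add (hA : 0 ≤ A) :
    posTrace A = posTrace (compression b F A) +
      posTrace ((1 - basisProj b F) * A * (1 - basisProj b F)) := by
  have hP := isSelfAdjoint_basisProj b F
  have hP' : IsSelfAdjoint (1 - basisProj b F) := (IsSelfAdjoint.one _).sub hP
  rw [posTrace_eq_tsum b hA, posTrace_eq_tsum b (compression_nonneg b F hA),
    posTrace_eq_tsum b (hP'.conjugate_nonneg hA), ← ENNReal.tsum_add]
  refine tsum_congr fun i => ?_
  rw [mul_apply_eq_comp ((1 - basisProj b F) * A), mul_apply_eq_comp (1 - basisProj b F),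
    show ⟪b i, (1 - basisProj b F) (A ((1 - basisProj b F) (b i)))⟫_ℂ = _ from
      (hP'.isSymmetric _ _).symm]
  by_cases hi : i ∈ F
  · simp [basisProj_basis_of_mem b hi, inner_compression_of_mem b hi hi]
  · simp [basisProj_basis_of_notMem b hi, compression_basis_of_notMem b hi]

theorem tendsto_ofReal_re_basisTrace (hA : 0 ≤ A) :
    Tendsto (fun F => ENNReal.ofReal (RCLike.re (basisTrace b F A))) atTop (𝓝 (posTrace A)) := by
  simp only [ofReal_re_basisTrace b _ hA, posTrace_eq_tsum b hA]
  exact ENNReal.summable.hasSum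

theorem traceNorm_compression_le (hX : IsSelfAdjoint X) :
    traceNorm (compression b F X) ≤ ENNReal.ofReal ‖X‖ * F.card := by
  have hP := isSelfAdjoint_basisProj b F
  have hle {Y : K →L[ℂ] K} (hY : IsSelfAdjoint Y) :
      compression b F Y ≤ ‖Y‖ • compression b F 1 := by
    have h := hP.conjugate_le_conjugate (hY.le_algebraMap_norm_self)
    rwa [Algebra.algebraMap_eq_smul_one, mul_smul_comm, smul_mul_assoc] at h
  have htrace : posTrace (compression b F (1 : K →L[ℂ] K)) = F.card := by
    rw [posTrace_compression b F zero_le_one, basisTrace_apply]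
    simp [b.orthonormal.norm_eq_one]
  rw [← htrace, ← posTrace_smul (norm_nonneg X)]
  refine traceNorm_le_posTrace ?_ (hle hX)
  have h := hle hX.neg
  rw [norm_neg, compression, mul_neg, neg_mul] at h
  exact neg_le.1 h

variable {F}

theorem smul_add_smul_mul_mul {R : Type*} [Ring R] [Algebra ℝ R] (s t : ℝ) (x y a : R) :
    (s • x + t • y) * a * (s • x + t • y) =
      s ^ 2 • (x * a * x) + (s * t) • (x * a * y + y * a * x) + t ^ 2 • (y * a * y) := by
  simp only [add_mul, mul_add, smul_mul_assoc, mul_smul_comm]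
  module

-- With `y = 1 - P`, the operator `G = δ P A P + (1 + δ⁻¹) y A y` satisfies
-- `G - (A - P A P) = δ⁻¹ (δ P - y) A (δ P - y)` and
-- `G + (A - P A P) = δ⁻¹ (δ P + y) A (δ P + y) + 2 y A y`.
theorem traceNorm_sub_compression_le_posTrace (hA : 0 ≤ A) {δ : ℝ} (hδ : 0 < δ) :
    traceNorm (A - compression b F A) ≤ posTrace (δ • compression b F A +
      (1 + δ⁻¹) • ((1 - basisProj b F) * A * (1 - basisProj b F))) := by
  have hP := isSelfAdjoint_basisProj b F
  have hy : IsSelfAdjoint (1 - basisProj b F) := (IsSelfAdjoint.one _).sub hP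
  have hconj (s : ℝ) := (((IsSelfAdjoint.all δ).smul hP).add
    ((IsSelfAdjoint.all s).smul hy)).conjugate_nonneg hA
  simp only [smul_add_smul_mul_mul] at hconj
  have hd := hy.conjugate_nonneg hA
  have hsub : A - compression b F A = basisProj b F * A * (1 - basisProj b F) +
      (1 - basisProj b F) * A * basisProj b F +
      (1 - basisProj b F) * A * (1 - basisProj b F) := by
    rw [compression]
    noncomm_ring
  rw [hsub, compression]
  generalize basisProj b F * A * basisProj b F = a at *
  generalize (1 - basisProj b F) * A * (1 - basisProj b F) = d at *
  generalize basisProj b F * A * (1 - basisProj b F) + (1 - basisProj b F) * A * basisProj b F = m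
    at *
  refine traceNorm_le_posTrace (sub_nonneg.1 ?_) (sub_nonneg.1 ?_)
  · convert add_nonneg (smul_nonneg (inv_nonneg.2 hδ.le) (hconj 1))
      (smul_nonneg zero_le_two hd : 0 ≤ (2 : ℝ) • d) using 1
    match_scalars <;> field_simp
    ring
  · convert smul_nonneg (inv_nonneg.2 hδ.le) (hconj (-1)) using 1
    match_scalars <;> field_simp
    ring

theorem traceNorm_sub_compression_le (hA : IsDensity A) {δ : ℝ} (hδ : 0 < δ) (hδ1 : δ ≤ 1)
    (h : 1 - δ ^ 2 ≤ RCLike.re (basisTrace b F A)) :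
    traceNorm (A - compression b F A) ≤ ENNReal.ofReal (3 * δ) := by
  have hA0 : 0 ≤ A := (ContinuousLinearMap.nonneg_iff_isPositive A).2 hA.1
  have hyA := ((IsSelfAdjoint.one _).sub (isSelfAdjoint_basisProj b F)).conjugate_nonneg hA0
  set t := RCLike.re (basisTrace b F A)
  set r := posTrace ((1 - basisProj b F) * A * (1 - basisProj b F))
  have hsum : ENNReal.ofReal t + r = 1 := by
    rw [← posTrace_compression b F hA0, ← posTrace_eq_compression_add b F hA0, hA.2]
  have hr : r ≤ ENNReal.ofReal (δ ^ 2) := by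
    refine (ENNReal.add_le_add_iff_left (a := ENNReal.ofReal t) ENNReal.ofReal_ne_top).1 ?_
    rw [hsum, ← ENNReal.ofReal_one]
    exact (ENNReal.ofReal_le_ofReal (by linarith)).trans ENNReal.ofReal_add_le
  refine (traceNorm_sub_compression_le_posTrace b hA0 hδ).trans ?_
  rw [posTrace_add (smul_nonneg hδ.le (compression_nonneg b F hA0))
    (smul_nonneg (by positivity) hyA), posTrace_smul hδ.le, posTrace_smul (by positivity),
    posTrace_compression b F hA0]
  calc ENNReal.ofReal δ * ENNReal.ofReal t + ENNReal.ofReal (1 + δ⁻¹) * r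
      ≤ ENNReal.ofReal δ * 1 + ENNReal.ofReal (1 + δ⁻¹) * ENNReal.ofReal (δ ^ 2) := by
        gcongr
        exact hsum ▸ le_self_add
    _ = ENNReal.ofReal (δ + (1 + δ⁻¹) * δ ^ 2) := by
        rw [mul_one, ← ENNReal.ofReal_mul (by positivity),
          ← ENNReal.ofReal_add hδ.le (by positivity)]
    _ ≤ ENNReal.ofReal (3 * δ) := by
        refine ENNReal.ofReal_le_ofReal ?_
        have : δ⁻¹ * δ ^ 2 = δ := by field_simp
        nlinarith

end Compression

section TraceNormConvergence

variable {K : Type*} [NormedAddCommGroup K] [InnerProductSpace ℂ K] [CompleteSpace K]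
  {A : K →L[ℂ] K} {ι : Type*} (b : HilbertBasis ι ℂ K)

theorem tendsto_zero_of_eventually_le_ofReal {α : Type*} {l : Filter α} {f : α → ENNReal} (c : ℝ)
    (h : ∀ δ, 0 < δ → δ < 1 → ∀ᶠ a in l, f a ≤ ENNReal.ofReal (c * δ)) : Tendsto f l (𝓝 0) := by
  refine ENNReal.tendsto_nhds_zero.2 fun ε hε => ?_
  have hc : Tendsto (fun δ : ℝ => ENNReal.ofReal (c * δ)) (𝓝[>] 0) (𝓝 0) := by
    have : Continuous fun δ : ℝ => ENNReal.ofReal (c * δ) :=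
      ENNReal.continuous_ofReal.comp (continuous_const_mul c)
    simpa using (this.tendsto 0).mono_left nhdsWithin_le_nhds
  obtain ⟨δ, hδ, hδ0, hδ1⟩ := ((ENNReal.tendsto_nhds_zero.1 hc ε hε).and
    (Ioo_mem_nhdsGT one_pos)).exists
  exact (h δ hδ0 hδ1).mono fun a ha => ha.trans hδ

theorem IsDensity.nonneg (hA : IsDensity A) : 0 ≤ A :=
  (ContinuousLinearMap.nonneg_iff_isPositive A).2 hA.1

theorem isDensity_iff_nonneg : IsDensity A ↔ 0 ≤ A ∧ posTrace A = 1 := by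
  rw [IsDensity, ContinuousLinearMap.nonneg_iff_isPositive]

theorem IsDensity.tendsto_re_basisTrace (hA : IsDensity A) :
    Tendsto (fun F => RCLike.re (basisTrace b F A)) atTop (𝓝 1) := by
  have h := (ENNReal.tendsto_toReal (hA.2 ▸ ENNReal.one_ne_top)).comp
    (tendsto_ofReal_re_basisTrace b hA.nonneg)
  rw [hA.2, ENNReal.toReal_one] at h
  refine h.congr fun F => ENNReal.toReal_ofReal ?_
  rw [basisTrace_apply, map_sum]
  exact Finset.sum_nonneg fun i _ => re_inner_nonneg hA.nonneg _

theorem tendsto_traceNorm_sub_compression (hA : IsDensity A) :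
    Tendsto (fun F => traceNorm (A - compression b F A)) atTop (𝓝 0) := by
  refine tendsto_zero_of_eventually_le_ofReal 3 fun δ hδ hδ1 => ?_
  filter_upwards [(hA.tendsto_re_basisTrace b).eventually_const_lt
    (sub_lt_self 1 (pow_pos hδ 2))] with F hF
  exact traceNorm_sub_compression_le b hA hδ hδ1.le hF.le

theorem tendsto_compression (hA : IsDensity A) :
    Tendsto (fun F => compression b F A) atTop (𝓝 A) := by
  rw [tendsto_iff_norm_sub_tendsto_zero]
  have h : Tendsto (fun F => ENNReal.ofReal ‖A - compression b F A‖) atTop (𝓝 0) :=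
    tendsto_of_tendsto_of_tendsto_of_le_of_le tendsto_const_nhds
      (tendsto_traceNorm_sub_compression b hA) (fun _ => zero_le) fun _ => norm_le_traceNorm _
  have h' := (ENNReal.tendsto_toReal ENNReal.zero_ne_top).comp h
  refine h'.congr fun F => ?_
  rw [Function.comp_apply, ENNReal.toReal_ofReal (norm_nonneg _), norm_sub_rev]

-- All the operators involved are close in trace norm to their compressions to one and the same
-- finite-dimensional subspace, on which the two norms are equivalent.
theorem tendsto_traceNorm_sub_of_tendsto {α : Type*} {l : Filter α} {f : α → K →L[ℂ] K}
    (hf : ∀ᶠ a in l, IsDensity (f a)) (hA : IsDensity A) (h : Tendsto f l (𝓝 A)) :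
    Tendsto (fun a => traceNorm (f a - A)) l (𝓝 0) := by
  refine tendsto_zero_of_eventually_le_ofReal 7 fun δ hδ hδ1 => ?_
  have hlt : 1 - δ ^ 2 < 1 := sub_lt_self 1 (pow_pos hδ 2)
  obtain ⟨F, hF⟩ := ((hA.tendsto_re_basisTrace (onb K)).eventually_const_lt hlt).exists
  have htrace : ∀ᶠ a in l, 1 - δ ^ 2 < RCLike.re (basisTrace (onb K) F (f a)) :=
    (((RCLike.continuous_re.comp (basisTrace (onb K) F).continuous).tendsto A).comp
      h).eventually_const_lt hF
  have hnorm : ∀ᶠ a in l, ‖f a - A‖ * F.card < δ := by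
    have := (tendsto_iff_norm_sub_tendsto_zero.1 h).mul_const (F.card : ℝ)
    rw [zero_mul] at this
    exact this.eventually_lt_const hδ
  filter_upwards [hf, htrace, hnorm] with a ha hFa hn
  have hsaA := hA.1.isSelfAdjoint
  have hsaf := ha.1.isSelfAdjoint
  have hc {X : K →L[ℂ] K} (hX : IsSelfAdjoint X) := isSelfAdjoint_compression (onb K) F hX
  have hcf := hsaf.sub (hc hsaf)
  calc traceNorm (f a - A)
      = traceNorm ((f a - compression (onb K) F (f a)) + compression (onb K) F (f a - A) +
          (compression (onb K) F A - A)) := by rw [compression_sub]; congr 1; abel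
    _ ≤ traceNorm (f a - compression (onb K) F (f a)) + traceNorm (compression (onb K) F (f a - A))
          + traceNorm (compression (onb K) F A - A) :=
        (traceNorm_add_le (hcf.add (hc (hsaf.sub hsaA))) ((hc hsaA).sub hsaA)).trans
          (add_le_add_left (traceNorm_add_le hcf (hc (hsaf.sub hsaA))) _)
    _ ≤ ENNReal.ofReal (3 * δ) + ENNReal.ofReal δ + ENNReal.ofReal (3 * δ) := by
        gcongr
        · exact traceNorm_sub_compression_le (onb K) ha hδ hδ1.le hFa.le
        · refine (traceNorm_compression_le (onb K) F (hsaf.sub hsaA)).trans ?_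
          rw [← ENNReal.ofReal_natCast, ← ENNReal.ofReal_mul (norm_nonneg _)]
          exact ENNReal.ofReal_le_ofReal hn.le
        · rw [traceNorm_sub_comm]
          exact traceNorm_sub_compression_le (onb K) hA hδ hδ1.le hF.le
    _ = ENNReal.ofReal (7 * δ) := by
        rw [← ENNReal.ofReal_add (by positivity) hδ.le,
          ← ENNReal.ofReal_add (by positivity) (by positivity)]
        ring_nf

-- Without the conservation of the partial traces, mass could escape in the limit.
theorem isDensity_of_tendsto {α : Type*} {l : Filter α} [l.NeBot] {f : α → K →L[ℂ] K}
    (hf : ∀ᶠ a in l, 0 ≤ f a) (h : Tendsto f l (𝓝 A)) {B : K →L[ℂ] K} (hB : IsDensity B)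
    (htrace : ∃ᶠ F in atTop, ∀ a, basisTrace b F (f a) = basisTrace b F B) : IsDensity A := by
  have hA : 0 ≤ A := ge_of_tendsto h hf
  have heq : ∃ᶠ F in atTop, ENNReal.ofReal (RCLike.re (basisTrace b F A)) =
      ENNReal.ofReal (RCLike.re (basisTrace b F B)) := htrace.mono fun F hF => by
    have hlim := ((basisTrace b F).continuous.tendsto A).comp h
    rw [tendsto_nhds_unique hlim (tendsto_const_nhds.congr fun a => (hF a).symm)]
  refine isDensity_iff_nonneg.2 ⟨hA, (tendsto_nhds_unique_of_frequently_eq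
    (tendsto_ofReal_re_basisTrace b hA) (tendsto_ofReal_re_basisTrace b hB.nonneg) heq).trans hB.2⟩

theorem isDensity_smul_compression (F : Finset ι) (hA : 0 ≤ A)
    (h : 0 < RCLike.re (basisTrace b F A)) :
    IsDensity ((RCLike.re (basisTrace b F A))⁻¹ • compression b F A) := by
  refine isDensity_iff_nonneg.2 ⟨smul_nonneg (inv_nonneg.2 h.le) (compression_nonneg b F hA), ?_⟩
  rw [posTrace_smul (inv_nonneg.2 h.le), posTrace_compression b F hA,
    ← ENNReal.ofReal_mul (inv_nonneg.2 h.le), inv_mul_cancel₀ h.ne', ENNReal.ofReal_one]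

theorem tendsto_traceNorm_sub_smul_compression (hA : IsDensity A) :
    Tendsto (fun F => traceNorm
      (A - (RCLike.re (basisTrace b F A))⁻¹ • compression b F A)) atTop (𝓝 0) := by
  have htrace := hA.tendsto_re_basisTrace b
  have h : Tendsto (fun F => (RCLike.re (basisTrace b F A))⁻¹ • compression b F A) atTop (𝓝 A) := by
    simpa using (htrace.inv₀ one_ne_zero).smul (tendsto_compression b hA)
  simp only [traceNorm_sub_comm A]
  refine tendsto_traceNorm_sub_of_tendsto ?_ hA h
  filter_upwards [htrace.eventually_const_lt one_pos] with F hF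
  exact isDensity_smul_compression b F hA.nonneg hF

end TraceNormConvergence

section StrictConvexity

variable {E : Type*} [NormedAddCommGroup E]

theorem eq_of_sum_eq_card_smul [InnerProductSpace ℂ E] {ι : Type*} [Fintype ι] {x : E} {y : ι → E}
    (hy : ∀ p, ‖y p‖ ≤ ‖x‖) (hsum : ∑ p, y p = (Fintype.card ι : ℂ) • x) (p : ι) : y p = x := by
  have hle (p : ι) : RCLike.re ⟪x, y p⟫_ℂ ≤ ‖x‖ ^ 2 :=
    (re_inner_le_norm x (y p)).trans (by nlinarith [hy p, norm_nonneg x])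
  have heq : ∑ p, RCLike.re ⟪x, y p⟫_ℂ = ∑ _p : ι, ‖x‖ ^ 2 := by
    rw [← map_sum, ← inner_sum, hsum, inner_smul_right, inner_self_eq_norm_sq_to_K]
    simp [← Complex.ofReal_pow]
  have hinner := (Finset.sum_eq_sum_iff_of_le fun p _ => hle p).1 heq p (Finset.mem_univ p)
  have hsq : ‖y p - x‖ ^ 2 ≤ 0 := by
    rw [norm_sub_sq (𝕜 := ℂ), inner_re_symm, hinner]
    nlinarith [hy p, norm_nonneg (y p)]
  exact sub_eq_zero.1 (norm_eq_zero.1 (pow_eq_zero_iff two_ne_zero |>.1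
    (le_antisymm hsq (sq_nonneg _))))

theorem eq_integral_of_norm_le [InnerProductSpace ℂ E] [CompleteSpace E] {C : Type*}
    [TopologicalSpace C] [MeasurableSpace C] {ν : Measure C} [IsProbabilityMeasure ν]
    [ν.IsOpenPosMeasure] {f : C → E} (hf : Continuous f) (h : ∀ σ, ‖f σ‖ ≤ ‖∫ σ, f σ ∂ν‖) (σ : C) :
    f σ = ∫ σ, f σ ∂ν := by
  let := InnerProductSpace.rclikeToReal ℂ E
  rcases ae_eq_const_or_norm_average_lt_of_norm_le_const (ae_of_all ν h) with hconst | hlt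
  · rw [average_eq_integral] at hconst
    exact congrFun ((Continuous.ae_eq_iff_eq ν hf continuous_const).1 hconst) σ
  · rw [average_eq_integral] at hlt
    exact absurd hlt (lt_irrefl _)

end StrictConvexity

section BasisRestrict

variable {K : Type*} [NormedAddCommGroup K] [InnerProductSpace ℂ K] {ι : Type*}
  (b : HilbertBasis ι ℂ K) (F : Finset ι)

/-- The restriction of an operator to the span of finitely many basis vectors, as an element of the
Hilbert space of Hilbert-Schmidt operators on this span. -/
def basisRestrict : (K →L[ℂ] K) →L[ℂ] PiLp 2 fun _ : F => K :=
  (PiLp.continuousLinearEquiv 2 ℂ fun _ : F => K).symm.toContinuousLinearMap.comp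
    (ContinuousLinearMap.pi fun i => ContinuousLinearMap.apply ℂ K (b i))

theorem basisRestrict_apply (A : K →L[ℂ] K) (i : F) : basisRestrict b F A i = A (b i) := rfl

variable [CompleteSpace K]

theorem norm_basisRestrict_sq (A : K →L[ℂ] K) :
    ‖basisRestrict b F A‖ ^ 2 = RCLike.re (basisTrace b F (star A * A)) := by
  rw [PiLp.norm_sq_eq_of_L2, basisTrace_apply, map_sum, ← Finset.sum_coe_sort F]
  refine Finset.sum_congr rfl fun i _ => ?_
  rw [basisRestrict_apply, mul_apply_eq_comp, ContinuousLinearMap.star_eq_adjoint,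
    ContinuousLinearMap.adjoint_inner_right, inner_self_eq_norm_sq]

variable {F}

theorem norm_basisRestrict_conj {V : K →L[ℂ] K} (hV : V ∈ unitary (K →L[ℂ] K))
    (h : Commute V (basisProj b F)) (A : K →L[ℂ] K) :
    ‖basisRestrict b F (V * A * star V)‖ = ‖basisRestrict b F A‖ := by
  have hstar : star (V * A * star V) * (V * A * star V) = V * (star A * A) * star V := by
    simp only [star_mul, star_star, mul_assoc]
    rw [← mul_assoc (star V) V, Unitary.star_mul_self_of_mem hV, one_mul]
  refine (pow_left_inj₀ (norm_nonneg _) (norm_nonneg _) two_ne_zero).1 ?_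
  rw [norm_basisRestrict_sq, norm_basisRestrict_sq, hstar, basisTrace_conj b hV h]

theorem continuous_basisRestrict_conj {C : Type*} [TopologicalSpace C] {W : C → K →L[ℂ] K}
    (hW : ∀ σ, W σ ∈ unitary (K →L[ℂ] K)) (hc : ∀ x, Continuous fun σ => W σ x) (A : K →L[ℂ] K) :
    Continuous fun σ => basisRestrict b F (W σ * A * star (W σ)) :=
  (PiLp.continuous_toLp 2 _).comp (continuous_pi fun i => continuous_conj W hW hc A (b i))

end BasisRestrict

section ConjAverage

variable {K : Type*} [NormedAddCommGroup K] [InnerProductSpace ℂ K] [CompleteSpace K]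
  {C : Type*} [TopologicalSpace C] [CompactSpace C] [MeasurableSpace C] [BorelSpace C]
  {W : C → K →L[ℂ] K} (hW : ∀ σ, W σ ∈ unitary (K →L[ℂ] K))
  (hc : ∀ x, Continuous fun σ => W σ x) (ν : Measure C) [IsProbabilityMeasure ν]
  {A : K →L[ℂ] K}

theorem norm_conjAverage_le : ‖conjAverage W hW hc ν‖ ≤ 1 :=
  LinearMap.mkContinuous₂_norm_le _ zero_le_one _

theorem inv_natCast_smul_nonneg (n : ℕ) (hA : 0 ≤ A) : 0 ≤ (n : ℂ)⁻¹ • A := by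
  rw [← Complex.ofReal_natCast, ← Complex.ofReal_inv, Complex.coe_smul]
  exact smul_nonneg (by positivity) hA

theorem map_conjAverage {E : Type*} [NormedAddCommGroup E] [NormedSpace ℂ E] [CompleteSpace E]
    (φ : K →L[ℂ] E) (A : K →L[ℂ] K) (y : K) :
    φ (conjAverage W hW hc ν A y) = ∫ σ, φ ((W σ * A * star (W σ)) y) ∂ν :=
  (φ.integral_comp_comm (integrable_conj W hW hc ν A y)).symm

theorem inner_conjAverage (A : K →L[ℂ] K) (x y : K) :
    ⟪x, conjAverage W hW hc ν A y⟫_ℂ = ∫ σ, ⟪x, (W σ * A * star (W σ)) y⟫_ℂ ∂ν :=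
  map_conjAverage hW hc ν (innerSL ℂ x) A y

open ComplexOrder in
theorem conjAverage_nonneg (hA : 0 ≤ A) : 0 ≤ conjAverage W hW hc ν A := by
  rw [ContinuousLinearMap.nonneg_iff_isPositive, ContinuousLinearMap.isPositive_iff_complex]
  intro x
  have h : 0 ≤ ⟪x, conjAverage W hW hc ν A x⟫_ℂ := by
    rw [inner_conjAverage]
    refine integral_nonneg fun σ => ?_
    exact ((ContinuousLinearMap.nonneg_iff_isPositive _).1
      (star_right_conjugate_nonneg hA (W σ))).inner_nonneg_right x
  obtain ⟨hre, him⟩ := Complex.nonneg_iff.1 h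
  rw [← inner_conj_symm, Complex.conj_eq_iff_im.2 him.symm]
  exact ⟨Complex.ext rfl him, hre⟩

theorem conjAverage_conj {P : K →L[ℂ] K} (hP : IsSelfAdjoint P) (h : ∀ σ, Commute (W σ) P) :
    conjAverage W hW hc ν (P * A * P) = P * conjAverage W hW hc ν A * P := by
  ext1 y
  rw [mul_apply_eq_comp, mul_apply_eq_comp, map_conjAverage, conjAverage_apply]
  refine integral_congr_ae (ae_of_all _ fun σ => ?_)
  have hstar : Commute (star (W σ)) P := hP.star_eq ▸ (h σ).star_star
  have hconj : W σ * (P * A * P) * star (W σ) = P * (W σ * A * star (W σ)) * P := by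
    simp only [mul_assoc, ← hstar.eq, (h σ).left_comm]
  exact congrArg (fun T : K →L[ℂ] K => T y) hconj

variable {ι : Type*} (b : HilbertBasis ι ℂ K) {F : Finset ι}

theorem basisTrace_conjAverage (h : ∀ σ, Commute (W σ) (basisProj b F)) (A : K →L[ℂ] K) :
    basisTrace b F (conjAverage W hW hc ν A) = basisTrace b F A := by
  simp only [basisTrace_apply, inner_conjAverage]
  rw [← integral_finsetSum _ fun i _ => (integrable_conj W hW hc ν A _).const_inner _]
  have hσ (σ : C) : ∑ i ∈ F, ⟪b i, (W σ * A * star (W σ)) (b i)⟫_ℂ = basisTrace b F A := by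
    rw [← basisTrace_apply, basisTrace_conj b (hW σ) (h σ)]
  simp only [hσ, integral_const, probReal_univ, one_smul, basisTrace_apply]

theorem basisRestrict_conjAverage (A : K →L[ℂ] K) : basisRestrict b F (conjAverage W hW hc ν A) =
    ∫ σ, basisRestrict b F (W σ * A * star (W σ)) ∂ν := by
  ext i
  refine (conjAverage_apply W hW hc ν A (b i)).trans (Eq.symm ?_)
  exact eval_integral_piLp (f := fun σ => basisRestrict b F (W σ * A * star (W σ)))
    (fun i => integrable_conj W hW hc ν A (b i)) i

theorem norm_basisRestrict_conjAverage_le (h : ∀ σ, Commute (W σ) (basisProj b F))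
    (A : K →L[ℂ] K) : ‖basisRestrict b F (conjAverage W hW hc ν A)‖ ≤ ‖basisRestrict b F A‖ := by
  rw [basisRestrict_conjAverage]
  refine (norm_integral_le_of_norm_le_const (ae_of_all ν fun σ =>
    (norm_basisRestrict_conj b (hW σ) (h σ) A).le)).trans_eq ?_
  rw [probReal_univ, mul_one]

theorem basisRestrict_conj_eq_of_conjAverage [ν.IsOpenPosMeasure]
    (h : ∀ σ, Commute (W σ) (basisProj b F))
    (hA : basisRestrict b F (conjAverage W hW hc ν A) = basisRestrict b F A) (σ : C) :
    basisRestrict b F (W σ * A * star (W σ)) = basisRestrict b F A := by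
  rw [← hA, basisRestrict_conjAverage]
  refine eq_integral_of_norm_le (continuous_basisRestrict_conj b hW hc A) (fun σ => ?_) σ
  rw [norm_basisRestrict_conj b (hW σ) (h σ), ← hA, basisRestrict_conjAverage]

end ConjAverage

section CollisionAverage

variable {H : Type*} [NormedAddCommGroup H] [InnerProductSpace ℂ H] [CompleteSpace H]
  {h : Hamiltonian H} {C : Type*} [MetricSpace C] [CompactSpace C] [MeasurableSpace C]
  [BorelSpace C] (S : CollisionSpec h C) {N : ℕ}

theorem card_pairs (N : ℕ) : Fintype.card {p : Fin N × Fin N // p.1 < p.2} = N.choose 2 := by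
  rw [Fintype.card_subtype, ← Finset.univ_product_univ, Finset.card_filter,
    Finset.sum_product_right, Nat.choose_two_right, ← Finset.sum_range_id,
    ← Fin.sum_univ_eq_sum_range]
  refine Finset.sum_congr rfl fun j _ => ?_
  rw [← Finset.card_filter, Finset.filter_gt_eq_Iio, Fin.card_Iio]

namespace CollisionSpec

variable {A : TensorPower H N →L[ℂ] TensorPower H N}

theorem sum_pairAverage (hN : 2 ≤ N) (A : TensorPower H N →L[ℂ] TensorPower H N) :
    ∑ p : {p : Fin N × Fin N // p.1 < p.2}, S.pairAverage p.1.1 p.1.2 p.2.ne A =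
      (Fintype.card {p : Fin N × Fin N // p.1 < p.2} : ℂ) • S.average N A := by
  have h : ((N.choose 2 : ℕ) : ℂ) ≠ 0 := Nat.cast_ne_zero.2 (Nat.choose_pos hN).ne'
  rw [card_pairs, average, smul_apply, sum_apply, smul_inv_smul₀ h]

theorem average_apply (A : TensorPower H N →L[ℂ] TensorPower H N) :
    S.average N A = ((N.choose 2 : ℕ) : ℂ)⁻¹ •
      ∑ p : {p : Fin N × Fin N // p.1 < p.2}, S.pairAverage p.1.1 p.1.2 p.2.ne A := by
  rw [average, smul_apply, sum_apply]

theorem norm_average_le (N : ℕ) : ‖S.average N‖ ≤ 1 := by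
  have := S.isProbabilityMeasure_ν
  refine ContinuousLinearMap.opNorm_le_bound _ zero_le_one fun A => ?_
  have hp (p : {p : Fin N × Fin N // p.1 < p.2}) :
      ‖S.pairAverage p.1.1 p.1.2 p.2.ne A‖ ≤ 1 * ‖A‖ :=
    ContinuousLinearMap.le_of_opNorm_le _ (norm_conjAverage_le _ _ _) A
  rw [average_apply, norm_smul, norm_inv, Complex.norm_natCast]
  refine inv_mul_le_of_le_mul₀ (Nat.cast_nonneg _) (by positivity) ?_
  refine (norm_sum_le_of_le _ fun p _ => hp p).trans_eq ?_
  rw [Finset.sum_const, Finset.card_univ, card_pairs, nsmul_eq_mul]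

theorem average_nonneg (hA : 0 ≤ A) : 0 ≤ S.average N A := by
  have := S.isProbabilityMeasure_ν
  rw [average_apply]
  exact inv_natCast_smul_nonneg _ (Finset.sum_nonneg fun p _ => conjAverage_nonneg _ _ _ hA)

variable {ι : Type*} (b : HilbertBasis ι ℂ (TensorPower H N)) {F : Finset ι}

/-- A finite set of basis vectors is invariant if all collisions preserve its span and the
orthogonal complement of its span. -/
def IsInvariant (F : Finset ι) : Prop :=
  ∀ i j (hij : i ≠ j) σ, Commute (pairOp i j hij (S.U σ)) (basisProj b F)

variable {S b}

theorem IsInvariant.average_compression (hF : S.IsInvariant b F)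
    (A : TensorPower H N →L[ℂ] TensorPower H N) :
    S.average N (compression b F A) = compression b F (S.average N A) := by
  have := S.isProbabilityMeasure_ν
  rw [average_apply, average_apply, compression, compression, mul_smul_comm, smul_mul_assoc,
    Finset.mul_sum, Finset.sum_mul]
  congr 1
  exact Finset.sum_congr rfl fun p _ =>
    conjAverage_conj _ _ _ (isSelfAdjoint_basisProj b F) (hF _ _ _)

theorem IsInvariant.basisTrace_average (hN : 2 ≤ N) (hF : S.IsInvariant b F)
    (A : TensorPower H N →L[ℂ] TensorPower H N) :
    basisTrace b F (S.average N A) = basisTrace b F A := by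
  have := S.isProbabilityMeasure_ν
  have hpair (p : {p : Fin N × Fin N // p.1 < p.2}) :
      basisTrace b F (S.pairAverage p.1.1 p.1.2 p.2.ne A) = basisTrace b F A :=
    basisTrace_conjAverage _ _ _ b (hF _ _ _) A
  have hcard : (Fintype.card {p : Fin N × Fin N // p.1 < p.2} : ℂ) ≠ 0 := by
    rw [card_pairs]
    exact Nat.cast_ne_zero.2 (Nat.choose_pos hN).ne'
  have hsum := congrArg (basisTrace b F) (S.sum_pairAverage hN A)
  simp only [map_sum, hpair, map_smul, Finset.sum_const, Finset.card_univ, nsmul_eq_mul,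
    smul_eq_mul] at hsum
  exact (mul_left_cancel₀ hcard hsum).symm

theorem IsInvariant.basisRestrict_conj_eq (hN : 2 ≤ N) (hF : S.IsInvariant b F)
    (hA : S.average N A = A) {i j : Fin N} (hij : i < j) (σ : C) :
    basisRestrict b F (pairOp i j hij.ne (S.U σ) * A * star (pairOp i j hij.ne (S.U σ))) =
      basisRestrict b F A := by
  have := S.isProbabilityMeasure_ν
  have := S.isOpenPosMeasure_ν
  refine basisRestrict_conj_eq_of_conjAverage
    (fun σ => pairOp_mem_unitary i j hij.ne (S.unitary_U σ)) (S.continuous_pairOp i j hij.ne)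
    S.ν b (hF i j hij.ne) ?_ σ
  refine eq_of_sum_eq_card_smul
    (y := fun p : {p : Fin N × Fin N // p.1 < p.2} =>
      basisRestrict b F (S.pairAverage p.1.1 p.1.2 p.2.ne A))
    (fun p => norm_basisRestrict_conjAverage_le _ _ _ b (hF _ _ _) A) ?_ ⟨(i, j), hij⟩
  rw [← map_sum, S.sum_pairAverage hN, hA, map_smul]

theorem commute_of_average_eq (hN : 2 ≤ N) (hb : ∀ i, ∃ F, i ∈ F ∧ S.IsInvariant b F)
    (hA : S.average N A = A) {i j : Fin N} (hij : i < j) (σ : C) :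
    Commute (pairOp i j hij.ne (S.U σ)) A := by
  have hU := pairOp_mem_unitary i j hij.ne (S.unitary_U σ)
  have hconj : pairOp i j hij.ne (S.U σ) * A * star (pairOp i j hij.ne (S.U σ)) = A := by
    refine ext_hilbertBasis b fun α => ?_
    obtain ⟨F, hα, hF⟩ := hb α
    exact congrArg (· ⟨α, hα⟩) (hF.basisRestrict_conj_eq hN hA hij σ)
  have h := congrArg (· * pairOp i j hij.ne (S.U σ)) hconj
  simp only [mul_assoc, Unitary.star_mul_self_of_mem hU, mul_one] at h
  exact h

end CollisionSpec

end CollisionAverage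

universe u

section CompactOperator

variable {H : Type u} [NormedAddCommGroup H] [InnerProductSpace ℂ H] {R : H →L[ℂ] H}

theorem exists_hilbertBasis_eigenvectors [CompleteSpace H] (hR : IsCompactOperator R)
    (hs : R.IsSymmetric) :
    ∃ (J : Type u) (ψ : HilbertBasis J ℂ H) (μ : J → ℝ), ∀ j, R (ψ j) = (μ j : ℂ) • ψ j := by
  let V (μ : ℂ) : Submodule ℂ H := Module.End.eigenspace R.toLinearMap μ
  have hV : OrthogonalFamily ℂ (fun μ => V μ) fun μ => (V μ).subtypeₗᵢ :=
    hs.orthogonalFamily_eigenspaces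
  have hc (μ : ℂ) : CompleteSpace (V μ) :=
    (ContinuousLinearMap.isClosed_eigenspace R μ).completeSpace_coe
  have hon := hV.orthonormal_sigma_orthonormal fun μ => (onb (V μ)).orthonormal
  let ψ := HilbertBasis.mkOfOrthogonalEqBot hon <| by
    rw [eq_bot_iff, ← R.orthogonalComplement_iSup_eigenspaces_eq_bot hR hs,
      ← Submodule.iInf_orthogonal]
    intro x hx
    refine Submodule.mem_iInf _ |>.2 fun μ => mem_orthogonal_of_inner_hilbertBasis (onb (V μ)) ?_
    exact fun i => (Submodule.mem_orthogonal _ _).1 hx _ (Submodule.subset_span ⟨⟨μ, i⟩, rfl⟩)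
  have hψ (j : (μ : ℂ) × OnbIdx (V μ)) : R (ψ j) = j.1 • ψ j := by
    rw [HilbertBasis.coe_mkOfOrthogonalEqBot]
    exact Module.End.mem_eigenspace_iff.1 (onb (V j.1) j.2).2
  refine ⟨_, ψ, fun j => j.1.re, fun j => ?_⟩
  have hreal : (j.1.re : ℂ) = j.1 := Complex.conj_eq_iff_re.1 <| hs.conj_eigenvalue_eq_self <|
    Module.End.hasEigenvalue_of_hasEigenvector
      ⟨Module.End.mem_eigenspace_iff.2 (hψ j), ψ.orthonormal.ne_zero j⟩
  rw [hreal, hψ]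

theorem norm_eigenvalue_le {J : Type*} {ψ : J → H} (hψ : Orthonormal ℂ ψ) {μ : J → ℂ}
    (hμ : ∀ j, R (ψ j) = μ j • ψ j) {j k : J} (hjk : j ≠ k) :
    ‖μ j‖ ≤ ‖R (ψ j) - R (ψ k)‖ := by
  have hinner : ⟪ψ j, R (ψ j) - R (ψ k)⟫_ℂ = μ j := by
    rw [hμ, hμ, inner_sub_right, inner_smul_right, inner_smul_right, hψ.inner_eq_zero hjk,
      inner_self_eq_norm_sq_to_K, hψ.norm_eq_one]
    simp
  have hle := norm_inner_le_norm (𝕜 := ℂ) (ψ j) (R (ψ j) - R (ψ k))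
  rwa [hinner, hψ.norm_eq_one, one_mul] at hle

theorem finite_le_norm_eigenvalue (hR : IsCompactOperator R) {J : Type*} {ψ : J → H}
    (hψ : Orthonormal ℂ ψ) {μ : J → ℂ} (hμ : ∀ j, R (ψ j) = μ j • ψ j) {r : ℝ} (hr : 0 < r) :
    {j | r ≤ ‖μ j‖}.Finite := by
  obtain ⟨K, hK, hRK⟩ := hR.image_closedBall_subset_compact (f := R.toLinearMap) 1
  obtain ⟨t, ht, hKt⟩ := Metric.totallyBounded_iff.1 hK.totallyBounded (r / 2) (half_pos hr)
  have hcover : {j | r ≤ ‖μ j‖} ⊆ ⋃ y ∈ t, {j | r ≤ ‖μ j‖ ∧ R (ψ j) ∈ Metric.ball y (r / 2)} := by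
    intro j hj
    have hmem : R (ψ j) ∈ K :=
      hRK ⟨ψ j, mem_closedBall_zero_iff.2 (hψ.norm_eq_one j).le, rfl⟩
    obtain ⟨y, hy, hball⟩ := Set.mem_iUnion₂.1 (hKt hmem)
    exact Set.mem_iUnion₂.2 ⟨y, hy, hj, hball⟩
  refine (ht.biUnion fun y _ => Set.Subsingleton.finite fun j hj k hk => ?_).subset hcover
  by_contra hjk
  have hdist := dist_triangle_right (R (ψ j)) (R (ψ k)) y
  rw [dist_eq_norm] at hdist
  linarith [Metric.mem_ball.1 hj.2, Metric.mem_ball.1 hk.2, hj.1, norm_eigenvalue_le hψ hμ hjk]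

end CompactOperator

namespace Hamiltonian

variable {H : Type u} [NormedAddCommGroup H] [InnerProductSpace ℂ H] [CompleteSpace H]
  (h : Hamiltonian H)

theorem inner_op (x y : h.op.domain) : ⟪h.op x, (y : H)⟫_ℂ = ⟪(x : H), h.op y⟫_ℂ := by
  have hadj := LinearPMap.adjoint_isFormalAdjoint h.selfAdjoint.dense_domain
  rw [LinearPMap.isSelfAdjoint_def.1 h.selfAdjoint] at hadj
  exact hadj x y

/-- The orthonormal basis `ψ` consists of eigenvectors of the Hamiltonian, with energies `e`. -/
def IsEigenbasis {J : Type*} (ψ : HilbertBasis J ℂ H) (e : J → ℝ) : Prop :=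
  ∀ j, ∃ hj : ψ j ∈ h.op.domain, h.op ⟨ψ j, hj⟩ = (e j : ℂ) • ψ j

variable {h}

theorem isSymmetric_of_rightInverse {z : ℝ} {R : H →L[ℂ] H}
    (hR : ∀ y, ∃ hy : R y ∈ h.op.domain, h.op ⟨R y, hy⟩ - (z : ℂ) • R y = y) : R.IsSymmetric := by
  intro x y
  obtain ⟨hx, hopx⟩ := hR x
  obtain ⟨hy, hopy⟩ := hR y
  have hinner := h.inner_op ⟨R x, hx⟩ ⟨R y, hy⟩
  rw [sub_eq_iff_eq_add'.1 hopx, sub_eq_iff_eq_add'.1 hopy, inner_add_left, inner_add_right,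
    inner_smul_left, inner_smul_right, Complex.conj_ofReal] at hinner
  exact (add_left_cancel hinner).symm

theorem exists_op_eq_of_rightInverse {z : ℝ} {R : H →L[ℂ] H}
    (hR : ∀ y, ∃ hy : R y ∈ h.op.domain, h.op ⟨R y, hy⟩ - (z : ℂ) • R y = y) {x : H} {μ : ℝ}
    (hx : R x = (μ : ℂ) • x) (hx0 : x ≠ 0) :
    ∃ hmem : x ∈ h.op.domain, h.op ⟨x, hmem⟩ = ((z + μ⁻¹ : ℝ) : ℂ) • x := by
  obtain ⟨hmem, hop⟩ := hR x
  have hμ : (μ : ℂ) ≠ 0 := by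
    intro h0
    have hzero : (⟨R x, hmem⟩ : h.op.domain) = 0 := Subtype.ext (hx.trans (by simp [h0]))
    rw [hzero, LinearPMap.map_zero, hx, h0, zero_smul, smul_zero, sub_zero] at hop
    exact hx0 hop.symm
  have hxR : x = (μ : ℂ)⁻¹ • R x := by rw [hx, inv_smul_smul₀ hμ]
  have hdom : x ∈ h.op.domain := hxR ▸ h.op.domain.smul_mem _ hmem
  refine ⟨hdom, ?_⟩
  have hsub : (⟨x, hdom⟩ : h.op.domain) = (μ : ℂ)⁻¹ • ⟨R x, hmem⟩ := Subtype.ext hxR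
  rw [hsub, LinearPMap.map_smul, sub_eq_iff_eq_add'.1 hop, smul_add, smul_comm, ← hxR,
    Complex.ofReal_add, Complex.ofReal_inv, add_smul]

theorem exists_isEigenbasis (h : Hamiltonian H) :
    ∃ (J : Type u) (ψ : HilbertBasis J ℂ H) (e : J → ℝ), h.IsEigenbasis ψ e := by
  obtain ⟨z, R, hcpt, hR, -⟩ := h.compactResolvent
  obtain ⟨J, ψ, μ, hμ⟩ := exists_hilbertBasis_eigenvectors hcpt (isSymmetric_of_rightInverse hR)
  exact ⟨J, ψ, fun j => z + (μ j)⁻¹, fun j =>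
    exists_op_eq_of_rightInverse hR (hμ j) (ψ.orthonormal.ne_zero j)⟩

namespace IsEigenbasis

variable {J : Type*} {ψ : HilbertBasis J ℂ H} {e : J → ℝ}

theorem bddBelow (hψ : h.IsEigenbasis ψ e) : BddBelow (Set.range e) := by
  obtain ⟨c, hc⟩ := h.boundedBelow
  refine ⟨c, Set.forall_mem_range.2 fun j => ?_⟩
  obtain ⟨hj, hop⟩ := hψ j
  have hle := hc ⟨ψ j, hj⟩
  rw [hop, inner_smul_right, inner_self_eq_norm_sq_to_K, ψ.orthonormal.norm_eq_one] at hle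
  simpa using hle

theorem finite_le (hψ : h.IsEigenbasis ψ e) (M : ℝ) : {j | e j ≤ M}.Finite := by
  obtain ⟨c, hc⟩ := hψ.bddBelow
  obtain ⟨z, R, hcpt, -, hR⟩ := h.compactResolvent
  have hsub (j : J) : ((e j - z : ℝ) : ℂ) • R (ψ j) = ψ j := by
    obtain ⟨hj, hop⟩ := hψ j
    have hinv := hR ⟨ψ j, hj⟩
    rwa [hop, ← sub_smul, map_smul, ← Complex.ofReal_sub] at hinv
  have hne (j : J) : ((e j - z : ℝ) : ℂ) ≠ 0 := fun h0 =>
    ψ.orthonormal.ne_zero j (by rw [← hsub j, h0, zero_smul])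
  have heig (j : J) : R (ψ j) = ((e j - z : ℝ) : ℂ)⁻¹ • ψ j := by
    rw [eq_inv_smul_iff₀ (hne j), hsub]
  refine (finite_le_norm_eigenvalue hcpt ψ.orthonormal heig
    (r := (|c - z| + |M - z| + 1)⁻¹) (by positivity)).subset fun j hj => ?_
  have hcj : c ≤ e j := hc ⟨j, rfl⟩
  have hjM : e j ≤ M := hj
  rw [Set.mem_ofPred_eq, norm_inv, Complex.norm_real, Real.norm_eq_abs]
  refine inv_anti₀ (abs_pos.2 (Complex.ofReal_ne_zero.1 (hne j))) ?_
  rw [abs_le]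
  constructor
  · linarith [neg_abs_le (c - z), abs_nonneg (M - z)]
  · linarith [le_abs_self (M - z), abs_nonneg (c - z)]

end IsEigenbasis

end Hamiltonian

section TensorBasis

theorem ext_multilinear_hilbertBasis {ι J E G : Type*} [Finite ι]
    [NormedAddCommGroup E] [InnerProductSpace ℂ E] [NormedAddCommGroup G] [NormedSpace ℂ G]
    (ψ : HilbertBasis J ℂ E) {f g : ContinuousMultilinearMap ℂ (fun _ : ι => E) G}
    (hfg : ∀ α : ι → J, f (fun k => ψ (α k)) = g fun k => ψ (α k)) : f = g := by
  classical
  have := Fintype.ofFinite ι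
  suffices h_range : ∀ (s : Finset ι) (φ : ι → E), (∀ k ∉ s, φ k ∈ Set.range ψ) → f φ = g φ from
    ContinuousMultilinearMap.ext fun φ => h_range Finset.univ φ (by simp)
  intro s
  induction s using Finset.induction_on with
  | empty =>
    intro φ hφ
    choose α hα using fun k => hφ k (Finset.notMem_empty k)
    simpa only [hα] using hfg α
  | insert a s _ ih =>
    intro φ hφ
    have h_factor : f.toContinuousLinearMap φ a = g.toContinuousLinearMap φ a := by
      refine ext_hilbertBasis ψ fun j => ih _ fun k hk => ?_
      by_cases hka : k = a
      · exact ⟨j, by simp [hka]⟩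
      · rw [Function.update_of_ne hka]
        exact hφ k (by simp [hka, hk])
    simpa using congrArg (fun T : E →L[ℂ] G => T (φ a)) h_factor

variable {H : Type*} [NormedAddCommGroup H] [InnerProductSpace ℂ H] [CompleteSpace H] {N : ℕ}

theorem norm_productVector (φ : Fin N → H) : ‖productVector φ‖ = ∏ k, ‖φ k‖ := by
  have h_sq : ((‖productVector φ‖ ^ 2 : ℝ) : ℂ) = (((∏ k, ‖φ k‖) ^ 2 : ℝ) : ℂ) := by
    have h_inner := inner_productVector φ φ
    simp only [inner_self_eq_norm_sq_to_K, Finset.prod_pow] at h_inner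
    exact_mod_cast h_inner
  exact (pow_left_inj₀ (norm_nonneg _) (Finset.prod_nonneg fun k _ => norm_nonneg _) two_ne_zero).1
    (Complex.ofReal_injective h_sq)

theorem productVector_apply_eq_compLinearMap (φ : Fin N → H) (α : Fin N → OnbIdx H) :
    productVector φ α = (MultilinearMap.mkPiAlgebra ℂ (Fin N) ℂ).compLinearMap
      (fun k => (lp.evalₗ (𝕜 := ℂ) (fun _ : OnbIdx H => ℂ) 2 (α k)).comp
        ((onb H).repr.toLinearEquiv : H →ₗ[ℂ] L2 (OnbIdx H))) φ := by
  simp [productVector_apply]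

/-- The tensor product of `N` vectors as a continuous multilinear map. -/
def productMap (H : Type*) [NormedAddCommGroup H] [InnerProductSpace ℂ H] [CompleteSpace H]
    (N : ℕ) : ContinuousMultilinearMap ℂ (fun _ : Fin N => H) (TensorPower H N) :=
  MultilinearMap.mkContinuous
    (MultilinearMap.mk' productVector
      (fun φ k x y => by
        ext α
        rw [lp.coeFn_add, Pi.add_apply]
        simp only [productVector_apply_eq_compLinearMap, MultilinearMap.map_update_add])
      (fun φ k c x => by
        ext α
        rw [lp.coeFn_smul, Pi.smul_apply]
        simp only [productVector_apply_eq_compLinearMap, MultilinearMap.map_update_smul]))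
    1 fun φ => by rw [one_mul]; exact (norm_productVector φ).le

variable {J : Type*} (ψ : HilbertBasis J ℂ H)

theorem orthonormal_productVector :
    Orthonormal ℂ fun α : Fin N → J => productVector fun k => ψ (α k) := by
  refine ⟨fun α => by simp [norm_productVector, ψ.orthonormal.1], fun α β hαβ => ?_⟩
  obtain ⟨k, hk⟩ := Function.ne_iff.1 hαβ
  dsimp only
  rw [inner_productVector]
  exact Finset.prod_eq_zero (Finset.mem_univ k) (ψ.orthonormal.2 hk)

theorem eq_zero_of_inner_productVector_hilbertBasis {x : TensorPower H N}
    (hx : ∀ α : Fin N → J, ⟪x, productVector fun k => ψ (α k)⟫_ℂ = 0) : x = 0 := by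
  have h_product : (innerSL ℂ x).compContinuousMultilinearMap (productMap H N) = 0 :=
    ext_multilinear_hilbertBasis ψ hx
  have h_inner : innerSL ℂ x = 0 := by
    refine ContinuousLinearMap.ext_on (dense_span_productVector N) ?_
    rintro _ ⟨φ, rfl⟩
    exact congrArg (fun f : ContinuousMultilinearMap ℂ (fun _ => H) ℂ => f φ) h_product
  exact inner_self_eq_zero.1 (congrArg (fun f : TensorPower H N →L[ℂ] ℂ => f x) h_inner)

/-- The Hilbert basis of product vectors of the tensor power formed from a Hilbert basis of `H`. -/
def tensorBasis (N : ℕ) : HilbertBasis (Fin N → J) ℂ (TensorPower H N) :=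
  HilbertBasis.mkOfOrthogonalEqBot (orthonormal_productVector ψ) <|
    (Submodule.eq_bot_iff _).2 fun _ hx => eq_zero_of_inner_productVector_hilbertBasis ψ fun α =>
      (Submodule.mem_orthogonal' _ _).1 hx _ (Submodule.subset_span ⟨α, rfl⟩)

theorem tensorBasis_apply (α : Fin N → J) :
    tensorBasis ψ N α = productVector fun k => ψ (α k) := by
  rw [tensorBasis, HilbertBasis.coe_mkOfOrthogonalEqBot]

end TensorBasis

section Block

variable {X Y Z : Type*} (e : Z ≃ X × Y)

/-- The section `slice e y` of square-summable families, as a bounded operator. -/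
def sliceCLM (y : Y) : L2 Z →L[ℂ] L2 X :=
  (slice e y).mkContinuous 1 fun f => by
    rw [one_mul]
    refine le_of_sq_le_sq ?_ (norm_nonneg _)
    rw [← tsum_slice e f]
    exact (summable_slice e f).le_tsum y fun _ _ => by positivity

theorem sliceCLM_comp_tensorOne (y : Y) (A : L2 X →L[ℂ] L2 X) :
    sliceCLM e y ∘L tensorOne e A = A ∘L sliceCLM e y :=
  ContinuousLinearMap.ext fun f => slice_tensorOne e A f y

theorem tensorOne_comp_adjoint_sliceCLM (y : Y) (A : L2 X →L[ℂ] L2 X) :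
    tensorOne e A ∘L (sliceCLM e y).adjoint = (sliceCLM e y).adjoint ∘L A := by
  have h_adj := congrArg ContinuousLinearMap.adjoint (sliceCLM_comp_tensorOne e y (star A))
  rwa [ContinuousLinearMap.adjoint_comp, ContinuousLinearMap.adjoint_comp,
    ← ContinuousLinearMap.star_eq_adjoint (tensorOne e (star A)),
    ← ContinuousLinearMap.star_eq_adjoint (star A), star_tensorOne, star_star] at h_adj

/-- The matrix blocks of an operator on `ℓ²(X) ⊗ ℓ²(Y)`, which are operators on `ℓ²(X)`. -/
def block (T : L2 Z →L[ℂ] L2 Z) (y y' : Y) : L2 X →L[ℂ] L2 X :=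
  sliceCLM e y ∘L T ∘L (sliceCLM e y').adjoint

theorem ext_block {T T' : L2 Z →L[ℂ] L2 Z} (h : ∀ y y', block e T y y' = block e T' y y') :
    T = T' := by
  have h_right (y' : Y) : T ∘L (sliceCLM e y').adjoint = T' ∘L (sliceCLM e y').adjoint :=
    ContinuousLinearMap.ext fun x => ext_slice e fun y =>
      congrArg (fun B : L2 X →L[ℂ] L2 X => B x) (h y y')
  have h_left (y' : Y) : sliceCLM e y' ∘L T.adjoint = sliceCLM e y' ∘L T'.adjoint := by
    simpa only [ContinuousLinearMap.adjoint_comp, ContinuousLinearMap.adjoint_adjoint] using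
      congrArg ContinuousLinearMap.adjoint (h_right y')
  exact ContinuousLinearMap.adjoint.injective <| ContinuousLinearMap.ext fun x =>
    ext_slice e fun y' => congrArg (fun B : L2 Z →L[ℂ] L2 X => B x) (h_left y')

theorem block_mul_tensorOne (T : L2 Z →L[ℂ] L2 Z) (A : L2 X →L[ℂ] L2 X) (y y' : Y) :
    block e (T * tensorOne e A) y y' = block e T y y' * A := by
  change sliceCLM e y ∘L (T ∘L tensorOne e A) ∘L _ = (sliceCLM e y ∘L T ∘L _) ∘L A
  simp only [ContinuousLinearMap.comp_assoc, tensorOne_comp_adjoint_sliceCLM]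

theorem block_tensorOne_mul (T : L2 Z →L[ℂ] L2 Z) (A : L2 X →L[ℂ] L2 X) (y y' : Y) :
    block e (tensorOne e A * T) y y' = A * block e T y y' := by
  change sliceCLM e y ∘L (tensorOne e A ∘L T) ∘L _ = A ∘L sliceCLM e y ∘L T ∘L _
  simp only [← ContinuousLinearMap.comp_assoc, sliceCLM_comp_tensorOne]

theorem commute_tensorOne_iff {T : L2 Z →L[ℂ] L2 Z} {A : L2 X →L[ℂ] L2 X} :
    Commute T (tensorOne e A) ↔ ∀ y y', Commute (block e T y y') A := by
  simp only [commute_iff_eq, ← block_mul_tensorOne, ← block_tensorOne_mul]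
  exact ⟨fun h _ _ => by rw [h], ext_block e⟩

theorem commute_tensorOne_of_mem_centralizer_centralizer {s : Set (L2 X →L[ℂ] L2 X)}
    {T : L2 Z →L[ℂ] L2 Z} (hT : ∀ A ∈ s, Commute T (tensorOne e A)) {B : L2 X →L[ℂ] L2 X}
    (hB : B ∈ s.centralizer.centralizer) : Commute T (tensorOne e B) :=
  (commute_tensorOne_iff e).2 fun y y' =>
    hB _ fun A hA => ((commute_tensorOne_iff e).1 (hT A hA) y y').eq.symm

end Block

section PairOp

variable {H : Type*} [NormedAddCommGroup H] [InnerProductSpace ℂ H] [CompleteSpace H] {N : ℕ}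

theorem pairOp_productVector_of_apply_eq_smul {i j : Fin N} (hij : i ≠ j)
    {A : TensorPower H 2 →L[ℂ] TensorPower H 2} {φ : Fin N → H} {c : ℂ}
    (hA : A (productVector ![φ i, φ j]) = c • productVector ![φ i, φ j]) :
    pairOp i j hij A (productVector φ) = c • productVector φ := by
  refine ext_slice (pairSplit _ i j hij) fun y => ?_
  rw [pairOp, slice_tensorOne, map_smul, slice_productVector, map_smul, hA, smul_comm]

end PairOp

section EnergyShell

theorem inner_symm_of_mem_topologicalClosure_span {K : Type*} [NormedAddCommGroup K]
    [InnerProductSpace ℂ K] {s : Set (K × K)} (hs : ∀ p ∈ s, ∀ q ∈ s, ⟪p.1, q.2⟫_ℂ = ⟪p.2, q.1⟫_ℂ)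
    {p q : K × K} (hp : p ∈ (Submodule.span ℂ s).topologicalClosure)
    (hq : q ∈ (Submodule.span ℂ s).topologicalClosure) : ⟪p.1, q.2⟫_ℂ = ⟪p.2, q.1⟫_ℂ := by
  have h_span : ∀ p ∈ Submodule.span ℂ s, ∀ q ∈ Submodule.span ℂ s,
      ⟪p.1, q.2⟫_ℂ - ⟪p.2, q.1⟫_ℂ ∈ ({0} : Set ℂ) := by
    simp only [Set.mem_singleton_iff, sub_eq_zero]
    intro p hp q hq
    induction hp, hq using Submodule.span_induction₂ with
    | mem_mem p q hp hq => exact hs p hp q hq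
    | zero_left | zero_right => simp
    | add_left _ _ _ _ _ _ h h' | add_right _ _ _ _ _ _ h h' => simp [h, h']
    | smul_left _ _ _ _ _ h | smul_right _ _ _ _ _ h => simp [h]
  have h_closure := map_mem_closure₂ (f := fun p q : K × K => ⟪p.1, q.2⟫_ℂ - ⟪p.2, q.1⟫_ℂ)
    (by fun_prop) hp hq h_span
  rwa [isClosed_singleton.closure_eq, Set.mem_singleton_iff, sub_eq_zero] at h_closure

namespace Hamiltonian

variable {H : Type*} [NormedAddCommGroup H] [InnerProductSpace ℂ H] [CompleteSpace H]
  {h : Hamiltonian H} {N : ℕ}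

theorem inner_productVector_update_comm {φ χ : Fin N → H} {k : Fin N} {x y : H}
    (hxy : ⟪φ k, y⟫_ℂ = ⟪x, χ k⟫_ℂ) :
    ⟪productVector φ, productVector (Function.update χ k y)⟫_ℂ
      = ⟪productVector (Function.update φ k x), productVector χ⟫_ℂ := by
  rw [inner_productVector, inner_productVector]
  refine Finset.prod_congr rfl fun l _ => ?_
  obtain rfl | hl := eq_or_ne l k
  · simp only [Function.update_self, hxy]
  · simp only [Function.update_of_ne hl]

theorem inner_symm_of_mem_graph {p q : TensorPower H N × TensorPower H N} (hp : p ∈ h.graph N)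
    (hq : q ∈ h.graph N) : ⟪p.1, q.2⟫_ℂ = ⟪p.2, q.1⟫_ℂ := by
  refine inner_symm_of_mem_topologicalClosure_span ?_ hp hq
  rintro _ ⟨φ, rfl⟩ _ ⟨χ, rfl⟩
  rw [inner_sum, sum_inner]
  exact Finset.sum_congr rfl fun k _ =>
    inner_productVector_update_comm (h.inner_op (φ k) (χ k)).symm

theorem inner_eq_zero_of_mem_shell {E E' : ℝ} (hE : E ≠ E') {x y : TensorPower H N}
    (hx : x ∈ h.shell N E) (hy : y ∈ h.shell N E') : ⟪x, y⟫_ℂ = 0 := by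
  have h_symm := inner_symm_of_mem_graph (p := (x, (E : ℂ) • x)) (q := (y, (E' : ℂ) • y)) hx hy
  simp only [inner_smul_left, inner_smul_right, Complex.conj_ofReal] at h_symm
  by_contra h0
  exact hE (Complex.ofReal_injective (mul_right_cancel₀ h0 h_symm)).symm

theorem productVector_mem_shell {φ : Fin N → H} {e : Fin N → ℝ}
    (hφ : ∀ k, ∃ hk : φ k ∈ h.op.domain, h.op ⟨φ k, hk⟩ = (e k : ℂ) • φ k) :
    productVector φ ∈ h.shell N (∑ k, e k) := by
  choose hd he using hφ
  have h_sum : ∑ k, productVector (Function.update φ k (h.op ⟨φ k, hd k⟩))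
      = ((∑ k, e k : ℝ) : ℂ) • productVector φ := by
    rw [Complex.ofReal_sum, Finset.sum_smul]
    refine Finset.sum_congr rfl fun k _ => ?_
    have h_update := (productMap H N).map_update_smul φ k (e k : ℂ) (φ k)
    rw [Function.update_eq_self] at h_update
    rw [he]
    exact h_update
  change (productVector φ, ((∑ k, e k : ℝ) : ℂ) • productVector φ) ∈ h.graph N
  rw [← h_sum]
  exact Submodule.le_topologicalClosure _ (Submodule.subset_span ⟨fun k => ⟨φ k, hd k⟩, rfl⟩)

theorem IsEigenbasis.productVector_pair_mem_shell {J : Type*} {ψ : HilbertBasis J ℂ H} {e : J → ℝ}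
    (hψ : h.IsEigenbasis ψ e) (a b : J) : productVector ![ψ a, ψ b] ∈ h.shell 2 (e a + e b) := by
  have h_mem : productVector ![ψ a, ψ b] ∈ h.shell 2 (∑ k, ![e a, e b] k) :=
    productVector_mem_shell (Fin.forall_fin_two.2 ⟨hψ a, hψ b⟩)
  rwa [Fin.sum_univ_two] at h_mem

theorem starProjection_shell_of_mem_of_ne {E E' : ℝ} (hE : E' ≠ E) {v : TensorPower H N}
    (hv : v ∈ h.shell N E) : (h.shell N E').starProjection v = 0 :=
  (Submodule.starProjection_apply_eq_zero_iff _).2 <|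
    (Submodule.mem_orthogonal _ _).2 fun _ hu => inner_eq_zero_of_mem_shell hE hu hv

section EnergyAlgebra

variable {A : TensorPower H N →L[ℂ] TensorPower H N} {f : ℝ → ℂ} {E : ℝ} {v : TensorPower H N}

theorem apply_eq_smul_of_mem_shell
    (hf : ∀ x, HasSum (fun E => f E • (h.shell N E).starProjection x) (A x))
    (hv : v ∈ h.shell N E) : A v = f E • v := by
  have h_single := hasSum_single (f := fun E' => f E' • (h.shell N E').starProjection v) E
    fun E' hE' => by rw [starProjection_shell_of_mem_of_ne hE' hv, smul_zero]
  rw [Submodule.starProjection_eq_self_iff.2 hv] at h_single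
  exact (hf v).unique h_single

theorem inner_apply_of_mem_shell
    (hf : ∀ x, HasSum (fun E => f E • (h.shell N E).starProjection x) (A x))
    (hv : v ∈ h.shell N E) (x : TensorPower H N) : ⟪v, A x⟫_ℂ = f E * ⟪v, x⟫_ℂ := by
  have h_term (E' : ℝ) : ⟪v, f E' • (h.shell N E').starProjection x⟫_ℂ
      = f E' * ⟪(h.shell N E').starProjection v, x⟫_ℂ := by
    rw [inner_smul_right, Submodule.inner_starProjection_left_eq_right]
  have h_single := hasSum_single (f := fun E' => f E' * ⟪(h.shell N E').starProjection v, x⟫_ℂ) E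
    fun E' hE' => by rw [starProjection_shell_of_mem_of_ne hE' hv, inner_zero_left, mul_zero]
  rw [Submodule.starProjection_eq_self_iff.2 hv] at h_single
  simp only [← h_term] at h_single
  exact ((innerSL ℂ v).hasSum (hf x)).unique h_single

theorem commute_rankOne_of_mem_energyAlgebra (hA : A ∈ h.energyAlgebra N)
    (hv : v ∈ h.shell N E) : Commute A (InnerProductSpace.rankOne ℂ v v) := by
  obtain ⟨f, -, hf⟩ := hA
  ext1 x
  rw [mul_apply_eq_comp, mul_apply_eq_comp, InnerProductSpace.rankOne_apply,
    InnerProductSpace.rankOne_apply, map_smul, apply_eq_smul_of_mem_shell hf hv,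
    inner_apply_of_mem_shell hf hv, smul_smul, mul_comm]

end EnergyAlgebra

end Hamiltonian

end EnergyShell

section EnergyConservation

variable {H : Type*} [NormedAddCommGroup H] [InnerProductSpace ℂ H] [CompleteSpace H]
  {h : Hamiltonian H} {C : Type*} [MetricSpace C] [CompactSpace C] [MeasurableSpace C]
  [BorelSpace C] {S : CollisionSpec h C} {N : ℕ} {J : Type*} {ψ : HilbertBasis J ℂ H} {e : J → ℝ}

theorem finite_sum_le (he : BddBelow (Set.range e)) (hfin : ∀ M : ℝ, {j | e j ≤ M}.Finite) (N : ℕ)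
    (M : ℝ) : {α : Fin N → J | ∑ k, e (α k) ≤ M}.Finite := by
  obtain ⟨c, hc⟩ := he
  refine (Set.Finite.pi' fun _ : Fin N => hfin (M - N * c + c)).subset fun α hα k => ?_
  have h_single : e (α k) - c ≤ ∑ l, (e (α l) - c) :=
    Finset.single_le_sum (f := fun l => e (α l) - c) (fun l _ => sub_nonneg.2 (hc ⟨α l, rfl⟩))
      (Finset.mem_univ k)
  rw [Finset.sum_sub_distrib, Finset.sum_const, Finset.card_univ, Fintype.card_fin,
    nsmul_eq_mul] at h_single
  rw [Set.mem_ofPred_eq] at hα ⊢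
  linarith

namespace CollisionSpec

theorem apply_mem_shell (S : CollisionSpec h C) (σ : C) {E : ℝ} {x : TensorPower H 2}
    (hx : x ∈ h.shell 2 E) : S.U σ x ∈ h.shell 2 E := by
  have h_graph := (S.commute_H2 σ x ((E : ℂ) • x)).2 hx
  rwa [map_smul] at h_graph

theorem inner_pairOp_eq_zero_of_energy_ne (hψ : h.IsEigenbasis ψ e) {i j : Fin N} (hij : i ≠ j)
    (σ : C) {α β : Fin N → J} (hE : ∑ k, e (α k) ≠ ∑ k, e (β k)) :
    ⟪tensorBasis ψ N α, pairOp i j hij (S.U σ) (tensorBasis ψ N β)⟫_ℂ = 0 := by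
  rw [tensorBasis_apply, tensorBasis_apply, inner_productVector_pairOp]
  by_cases hαβ : ∃ k, (k ≠ i ∧ k ≠ j) ∧ α k ≠ β k
  · obtain ⟨k, hk, hne⟩ := hαβ
    rw [Finset.prod_eq_zero (Finset.mem_univ ⟨k, hk⟩) (ψ.orthonormal.2 hne), mul_zero]
  · push Not at hαβ
    have h_pair : e (α i) + e (α j) ≠ e (β i) + e (β j) := by
      refine fun h0 => hE (sub_eq_zero.1 ?_)
      rw [← Finset.sum_sub_distrib, ← Finset.sum_subset (Finset.subset_univ {i, j}),
        Finset.sum_pair hij]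
      · linarith
      · intro k _ hk
        rw [hαβ k (by simpa using hk), sub_self]
    rw [Hamiltonian.inner_eq_zero_of_mem_shell h_pair (hψ.productVector_pair_mem_shell _ _)
      (S.apply_mem_shell σ (hψ.productVector_pair_mem_shell _ _)), zero_mul]

theorem isInvariant_of_mem_iff (hψ : h.IsEigenbasis ψ e) {F : Finset (Fin N → J)} {M : ℝ}
    (hF : ∀ α, α ∈ F ↔ ∑ k, e (α k) ≤ M) : S.IsInvariant (tensorBasis ψ N) F := by
  refine fun i j hij σ => commute_basisProj _ (fun α hα β hβ => ?_) fun α hα β hβ => ?_ <;>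
    rw [hF] at hα hβ <;>
    exact inner_pairOp_eq_zero_of_energy_ne hψ hij σ fun h_eq => by simp_all

theorem frequently_isInvariant (S : CollisionSpec h C) (hψ : h.IsEigenbasis ψ e) (N : ℕ) :
    ∃ᶠ F in atTop, S.IsInvariant (tensorBasis ψ N) F := by
  refine frequently_atTop.2 fun G => ?_
  obtain ⟨M, hM⟩ := (G.finite_toSet.image fun α => ∑ k, e (α k)).bddAbove
  refine ⟨(finite_sum_le hψ.bddBelow hψ.finite_le N M).toFinset, fun α hα => ?_,
    isInvariant_of_mem_iff hψ (M := M) (by simp)⟩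
  simpa using hM ⟨α, hα, rfl⟩

end CollisionSpec

end EnergyConservation

section Ergodicity

theorem inner_eq_zero_of_commute {K : Type*} [NormedAddCommGroup K] [InnerProductSpace ℂ K]
    [CompleteSpace K] {P A : K →L[ℂ] K} (hP : IsSelfAdjoint P) (h : Commute A P) {x y : K}
    (hx : P x = x) (hy : P y = 0) : ⟪y, A x⟫_ℂ = 0 := by
  calc ⟪y, A x⟫_ℂ = ⟪y, (A * P) x⟫_ℂ := by rw [mul_apply_eq_comp, hx]
    _ = ⟪P y, A x⟫_ℂ := by
      rw [h.eq, mul_apply_eq_comp, ← ContinuousLinearMap.adjoint_inner_left, hP.adjoint_eq]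
    _ = 0 := by rw [hy, inner_zero_left]

variable {H : Type*} [NormedAddCommGroup H] [InnerProductSpace ℂ H] [CompleteSpace H]
  {h : Hamiltonian H} {C : Type*} [MetricSpace C] [CompactSpace C] [MeasurableSpace C]
  [BorelSpace C] {S : CollisionSpec h C} {N : ℕ} {J : Type*} {ψ : HilbertBasis J ℂ H} {e : J → ℝ}

theorem isSelfAdjoint_pairOp {i j : Fin N} (hij : i ≠ j)
    {A : TensorPower H 2 →L[ℂ] TensorPower H 2} (hA : IsSelfAdjoint A) :
    IsSelfAdjoint (pairOp i j hij A) := by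
  rw [IsSelfAdjoint, pairOp, star_tensorOne, hA.star_eq]

theorem pairOp_rankOne_tensorBasis_self (ψ : HilbertBasis J ℂ H) {i j : Fin N} (hij : i ≠ j)
    (α : Fin N → J) :
    pairOp i j hij (InnerProductSpace.rankOne ℂ (productVector ![ψ (α i), ψ (α j)])
      (productVector ![ψ (α i), ψ (α j)])) (tensorBasis ψ N α) = tensorBasis ψ N α := by
  rw [tensorBasis_apply, pairOp_productVector_of_apply_eq_smul (c := 1), one_smul]
  rw [InnerProductSpace.rankOne_apply, inner_self_eq_norm_sq_to_K, norm_productVector]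
  simp [Fin.prod_univ_two, ψ.orthonormal.1]

theorem pairOp_rankOne_tensorBasis_of_ne (ψ : HilbertBasis J ℂ H) {i j : Fin N} (hij : i ≠ j)
    {α β : Fin N → J} (hαβ : α i ≠ β i ∨ α j ≠ β j) :
    pairOp i j hij (InnerProductSpace.rankOne ℂ (productVector ![ψ (α i), ψ (α j)])
      (productVector ![ψ (α i), ψ (α j)])) (tensorBasis ψ N β) = 0 := by
  rw [tensorBasis_apply, pairOp_productVector_of_apply_eq_smul (c := 0), zero_smul]
  rw [InnerProductSpace.rankOne_apply, inner_productVector, Fin.prod_univ_two, zero_smul]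
  refine smul_eq_zero_of_left (mul_eq_zero.2 ?_) _
  exact hαβ.imp (fun hi => ψ.orthonormal.2 hi) fun hj => ψ.orthonormal.2 hj

namespace CollisionSpec

theorem IsErgodic.rankOne_mem_centralizer_centralizer (hS : S.IsErgodic) {E : ℝ}
    {v : TensorPower H 2} (hv : v ∈ h.shell 2 E) :
    InnerProductSpace.rankOne ℂ v v ∈ (Set.range S.U).centralizer.centralizer := by
  rw [show (Set.range S.U).centralizer = h.energyAlgebra 2 from hS]
  exact fun A hA => Hamiltonian.commute_rankOne_of_mem_energyAlgebra hA hv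

theorem IsErgodic.inner_eq_zero_of_average_eq (hS : S.IsErgodic) (hN : 2 ≤ N)
    (hψ : h.IsEigenbasis ψ e) {A : TensorPower H N →L[ℂ] TensorPower H N}
    (hA : S.average N A = A) {α β : Fin N → J} (hαβ : α ≠ β) :
    ⟪tensorBasis ψ N β, A (tensorBasis ψ N α)⟫_ℂ = 0 := by
  have hpair {i j : Fin N} (hij : i < j) (hne : α i ≠ β i ∨ α j ≠ β j) :
      ⟪tensorBasis ψ N β, A (tensorBasis ψ N α)⟫_ℂ = 0 := by
    refine inner_eq_zero_of_commute
      (isSelfAdjoint_pairOp hij.ne (InnerProductSpace.isPositive_rankOne_self _).isSelfAdjoint)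
      (commute_tensorOne_of_mem_centralizer_centralizer _ (Set.forall_mem_range.2 fun σ => ?_)
        (hS.rankOne_mem_centralizer_centralizer (hψ.productVector_pair_mem_shell _ _)))
      (pairOp_rankOne_tensorBasis_self ψ hij.ne α) (pairOp_rankOne_tensorBasis_of_ne ψ hij.ne hne)
    refine (commute_of_average_eq (b := tensorBasis ψ N) hN (fun γ => ?_) hA hij σ).symm
    obtain ⟨F, hF, hFinv⟩ := frequently_atTop.1 (S.frequently_isInvariant hψ N) {γ}
    exact ⟨F, hF (Finset.mem_singleton_self γ), hFinv⟩
  obtain ⟨k, hk⟩ := Function.ne_iff.1 hαβ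
  have : Nontrivial (Fin N) := Fin.nontrivial_iff_two_le.2 hN
  obtain ⟨l, hl⟩ := exists_ne k
  rcases lt_or_gt_of_ne hl with hlt | hlt
  · exact hpair hlt (Or.inr hk)
  · exact hpair hlt (Or.inl hk)

end CollisionSpec

end Ergodicity

section Separability

section Diagonal

variable {K : Type*} [NormedAddCommGroup K] [InnerProductSpace ℂ K] {ι : Type*}
  (b : HilbertBasis ι ℂ K) (F : Finset ι)

theorem compression_eq_sum (A : K →L[ℂ] K) : compression b F A
    = ∑ i ∈ F, ∑ j ∈ F, ⟪b i, A (b j)⟫_ℂ • InnerProductSpace.rankOne ℂ (b i) (b j) := by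
  ext1 x
  simp only [compression, mul_apply_eq_comp, basisProj_apply, map_sum, map_smul, sum_apply,
    smul_apply, InnerProductSpace.rankOne_apply, Finset.smul_sum, smul_smul]
  rw [Finset.sum_comm]
  exact Finset.sum_congr rfl fun i _ => Finset.sum_congr rfl fun j _ => by rw [mul_comm]

variable {A : K →L[ℂ] K}

theorem smul_compression_mem_convexHull (hA : 0 ≤ A) (hd : ∀ i j, i ≠ j → ⟪b i, A (b j)⟫_ℂ = 0)
    (htrace : 0 < RCLike.re (basisTrace b F A)) :
    (RCLike.re (basisTrace b F A))⁻¹ • compression b F A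
      ∈ convexHull ℝ (Set.range fun i => InnerProductSpace.rankOne ℂ (b i) (b i)) := by
  have h_diag (i : ι) : ((RCLike.re ⟪b i, A (b i)⟫_ℂ : ℝ) : ℂ) = ⟪b i, A (b i)⟫_ℂ :=
    ((ContinuousLinearMap.nonneg_iff_isPositive A).1 hA).isSymmetric.coe_re_inner_self_apply (b i)
  have h_sum : compression b F A
      = ∑ i ∈ F, RCLike.re ⟪b i, A (b i)⟫_ℂ • InnerProductSpace.rankOne ℂ (b i) (b i) := by
    rw [compression_eq_sum]
    refine Finset.sum_congr rfl fun i hi => ?_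
    rw [Finset.sum_eq_single_of_mem i hi fun j _ hj => by rw [hd i j hj.symm, zero_smul],
      ← Complex.coe_smul, h_diag]
  have h_trace : RCLike.re (basisTrace b F A) = ∑ i ∈ F, RCLike.re ⟪b i, A (b i)⟫_ℂ := by
    rw [basisTrace_apply, map_sum]
  rw [h_trace] at htrace ⊢
  rw [h_sum]
  exact F.centerMass_mem_convexHull (fun i _ => re_inner_nonneg hA (b i)) htrace
    fun i _ => Set.mem_range_self i

theorem isDensity_rankOne [CompleteSpace K] {v : K} (hv : ‖v‖ = 1) :
    IsDensity (InnerProductSpace.rankOne ℂ v v) := by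
  refine ⟨InnerProductSpace.isPositive_rankOne_self v, ?_⟩
  have h_diag (j) : RCLike.re ⟪onb K j, InnerProductSpace.rankOne ℂ v v (onb K j)⟫_ℂ
      = ‖⟪onb K j, v⟫_ℂ‖ ^ 2 := by
    rw [InnerProductSpace.rankOne_apply, inner_smul_right, ← inner_conj_symm, RCLike.conj_mul]
    exact_mod_cast Complex.ofReal_re _
  simp only [posTrace, h_diag, tsum_ofReal_norm_inner_sq, hv, one_pow, ENNReal.ofReal_one]

end Diagonal

variable {H : Type*} [NormedAddCommGroup H] [InnerProductSpace ℂ H] [CompleteSpace H]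
  {J : Type*} (ψ : HilbertBasis J ℂ H) {N : ℕ}

theorem rankOne_tensorBasis_mem_productStates (α : Fin N → J) :
    InnerProductSpace.rankOne ℂ (tensorBasis ψ N α) (tensorBasis ψ N α) ∈ productStates H N := by
  refine ⟨isDensity_rankOne ((tensorBasis ψ N).orthonormal.1 α),
    fun k => InnerProductSpace.rankOne ℂ (ψ (α k)) (ψ (α k)),
    fun k => isDensity_rankOne (ψ.orthonormal.1 _), fun φ => ?_⟩
  simp only [InnerProductSpace.rankOne_apply, tensorBasis_apply, inner_productVector]
  exact ((productMap H N).map_smul_univ _ _).symm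

theorem isSeparable_of_diagonal {ϱ : TensorPower H N →L[ℂ] TensorPower H N} (hϱ : IsDensity ϱ)
    (hd : ∀ α β, α ≠ β → ⟪tensorBasis ψ N α, ϱ (tensorBasis ψ N β)⟫_ℂ = 0) : IsSeparable ϱ := by
  refine ⟨hϱ, fun ε hε => ?_⟩
  have h_trace := (hϱ.tendsto_re_basisTrace (tensorBasis ψ N)).eventually_const_lt one_pos
  have h_dist :=
    (tendsto_traceNorm_sub_smul_compression (tensorBasis ψ N) hϱ).eventually_lt_const hε
  obtain ⟨F, htrace, hdist⟩ := (h_trace.and h_dist).exists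
  exact ⟨_, convexHull_mono (Set.range_subset_iff.2 (rankOne_tensorBasis_mem_productStates ψ))
    (smul_compression_mem_convexHull _ F hϱ.nonneg hd htrace), hdist⟩

end Separability

section Operators

variable {K : Type*} [NormedAddCommGroup K] [InnerProductSpace ℂ K]

-- Instance search finds `PosSMulMono` for an abstract `K`, but not for `K = TensorPower H N`.
theorem nonneg_expSemigroup_apply [CompleteSpace K] {Q : (K →L[ℂ] K) →L[ℂ] (K →L[ℂ] K)}
    (hQ : ∀ A, 0 ≤ A → 0 ≤ Q A) {s : ℝ} (hs : 0 ≤ s) {A : K →L[ℂ] K} (hA : 0 ≤ A) :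
    0 ≤ expSemigroup (Q - 1) s A :=
  expSemigroup_apply_nonneg hQ hs hA

variable {ι : Type*} (b : HilbertBasis ι ℂ K) (F : Finset ι)

instance finiteDimensional_range_compression :
    FiniteDimensional ℂ (LinearMap.mulLeftRight ℂ (basisProj b F, basisProj b F)).range := by
  have := FiniteDimensional.span_of_finite ℂ <| Set.finite_range fun p : F × F =>
    InnerProductSpace.rankOne ℂ (b p.1) (b p.2)
  refine Submodule.finiteDimensional_of_le (S₂ := Submodule.span ℂ (Set.range fun p : F × F =>
    InnerProductSpace.rankOne ℂ (b p.1) (b p.2))) ?_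
  rintro _ ⟨A, rfl⟩
  change compression b F A ∈ _
  rw [compression_eq_sum]
  exact Submodule.sum_mem _ fun i hi => Submodule.sum_mem _ fun j hj =>
    Submodule.smul_mem _ _ (Submodule.subset_span ⟨(⟨i, hi⟩, ⟨j, hj⟩), rfl⟩)

end Operators

namespace CollisionSpec

variable {H : Type*} [NormedAddCommGroup H] [InnerProductSpace ℂ H] [CompleteSpace H]
  {h : Hamiltonian H} {C : Type*} [MetricSpace C] [CompactSpace C] [MeasurableSpace C]
  [BorelSpace C] (S : CollisionSpec h C) {N : ℕ} {A ϱ₀ : TensorPower H N →L[ℂ] TensorPower H N}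

theorem generator_eq_zero_iff (hN : N ≠ 0) : S.generator N A = 0 ↔ S.average N A = A := by
  change (N : ℂ) • (S.average N A - A) = 0 ↔ _
  rw [smul_eq_zero_iff_right (Nat.cast_ne_zero.2 hN), sub_eq_zero]

theorem evolution_eq_expSemigroup (N : ℕ) (t : ℝ) :
    S.evolution N t = expSemigroup (S.average N - 1) (t * N) := by
  rw [evolution, expSemigroup, expSemigroup, generator, smul_smul, Complex.ofReal_mul,
    Complex.ofReal_natCast]

theorem evolution_nonneg (hA : 0 ≤ A) {t : ℝ} (ht : 0 ≤ t) : 0 ≤ S.evolution N t A := by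
  rw [evolution_eq_expSemigroup]
  exact nonneg_expSemigroup_apply (fun _ => S.average_nonneg) (by positivity) hA

variable {S} {ι : Type*} {b : HilbertBasis ι ℂ (TensorPower H N)}

theorem IsInvariant.basisTrace_evolution {F : Finset ι} (hF : S.IsInvariant b F) (hN : 2 ≤ N)
    (A : TensorPower H N →L[ℂ] TensorPower H N) (t : ℝ) :
    basisTrace b F (S.evolution N t A) = basisTrace b F A := by
  rw [evolution_eq_expSemigroup]
  exact map_expSemigroup_apply _ (hF.basisTrace_average hN) _ _

theorem IsInvariant.compression_mem_ker_sup_range {F : Finset ι} (hF : S.IsInvariant b F)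
    (A : TensorPower H N →L[ℂ] TensorPower H N) :
    compression b F A ∈ (S.average N - 1).ker ⊔ (S.average N - 1).range := by
  refine mem_ker_sup_range_of_finiteDimensional (S.norm_average_le N)
    (V := (LinearMap.mulLeftRight ℂ (basisProj b F, basisProj b F)).range) ?_ ⟨A, rfl⟩
  rintro _ ⟨B, rfl⟩
  exact ⟨S.average N B, (hF.average_compression B).symm⟩

theorem isDensity_evolution (hN : 2 ≤ N) (hb : ∃ᶠ F in atTop, S.IsInvariant b F)
    (hϱ₀ : IsDensity ϱ₀) {t : ℝ} (ht : 0 ≤ t) : IsDensity (S.evolution N t ϱ₀) :=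
  isDensity_of_tendsto b (l := pure ()) (f := fun _ => S.evolution N t ϱ₀)
    (Eventually.of_forall fun _ => S.evolution_nonneg hϱ₀.nonneg ht) tendsto_const_nhds hϱ₀
    (hb.mono fun _ hF _ => hF.basisTrace_evolution hN ϱ₀ t)

theorem exists_tendsto_evolution (hN : N ≠ 0) (hb : ∃ᶠ F in atTop, S.IsInvariant b F)
    (hϱ₀ : IsDensity ϱ₀) :
    ∃ ϱ, S.average N ϱ = ϱ ∧ Tendsto (fun t => S.evolution N t ϱ₀) atTop (𝓝 ϱ) := by
  have h_closure : ϱ₀ ∈ ((S.average N - 1).ker ⊔ (S.average N - 1).range).topologicalClosure :=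
    mem_closure_of_frequently_of_tendsto
      (hb.mono fun _ hF => hF.compression_mem_ker_sup_range ϱ₀) (tendsto_compression b hϱ₀)
  obtain ⟨ϱ, hfix, hlim⟩ := exists_tendsto_expSemigroup (S.norm_average_le N) h_closure
  refine ⟨ϱ, hfix, ?_⟩
  simp only [evolution_eq_expSemigroup]
  exact hlim.comp (tendsto_id.atTop_mul_const (Nat.cast_pos.2 (Nat.pos_of_ne_zero hN)))

theorem exists_tendsto_traceNorm_evolution (hN : 2 ≤ N) (hb : ∃ᶠ F in atTop, S.IsInvariant b F)
    (hϱ₀ : IsDensity ϱ₀) :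
    ∃ ϱ, IsDensity ϱ ∧ S.average N ϱ = ϱ ∧
      Tendsto (fun t => traceNorm (S.evolution N t ϱ₀ - ϱ)) atTop (𝓝 0) := by
  obtain ⟨ϱ, hfix, hlim⟩ := exists_tendsto_evolution (by omega) hb hϱ₀
  have hϱ : IsDensity ϱ := isDensity_of_tendsto b
    ((eventually_ge_atTop 0).mono fun _ => S.evolution_nonneg hϱ₀.nonneg) hlim hϱ₀
    (hb.mono fun _ hF => hF.basisTrace_evolution hN ϱ₀)
  have hdensity : ∀ᶠ t in atTop, IsDensity (S.evolution N t ϱ₀) :=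
    (eventually_ge_atTop 0).mono fun _ => isDensity_evolution hN hb hϱ₀
  exact ⟨ϱ, hϱ, hfix, tendsto_traceNorm_sub_of_tendsto hdensity hϱ hlim⟩

end CollisionSpec

end QuantumKac

end

theorem corollary2p17 {H : Type*} [NormedAddCommGroup H] [InnerProductSpace ℂ H] [CompleteSpace H]
    [TopologicalSpace.SeparableSpace H]
    {C : Type*} [MetricSpace C] [CompactSpace C] [MeasurableSpace C] [BorelSpace C]
    (h : QuantumKac.Hamiltonian H) (S : QuantumKac.CollisionSpec h C) (hS : S.IsErgodic)
    (N : ℕ) (hN : 2 ≤ N) :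
    (∀ ϱ : QuantumKac.TensorPower H N →L[ℂ] QuantumKac.TensorPower H N,
      QuantumKac.IsDensity ϱ → S.generator N ϱ = 0 → QuantumKac.IsSeparable ϱ) ∧
    (∀ ϱ₀ : QuantumKac.TensorPower H N →L[ℂ] QuantumKac.TensorPower H N,
      QuantumKac.IsDensity ϱ₀ →
        ∃ ϱ : QuantumKac.TensorPower H N →L[ℂ] QuantumKac.TensorPower H N,
          QuantumKac.IsDensity ϱ ∧ S.generator N ϱ = 0 ∧ QuantumKac.IsSeparable ϱ ∧
          Tendsto (fun t : ℝ => QuantumKac.traceNorm (S.evolution N t ϱ₀ - ϱ)) atTop (𝓝 0)) := by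
  obtain ⟨J, ψ, e, hψ⟩ := h.exists_isEigenbasis
  have hgenerator {ϱ} : S.generator N ϱ = 0 ↔ S.average N ϱ = ϱ :=
    S.generator_eq_zero_iff (by omega)
  have hseparable {ϱ} (hϱ : QuantumKac.IsDensity ϱ) (hfix : S.average N ϱ = ϱ) :
      QuantumKac.IsSeparable ϱ :=
    QuantumKac.isSeparable_of_diagonal ψ hϱ fun _ _ hne =>
      hS.inner_eq_zero_of_average_eq hN hψ hfix hne.symm
  refine ⟨fun ϱ hϱ hgen => hseparable hϱ (hgenerator.1 hgen), fun ϱ₀ hϱ₀ => ?_⟩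
  have hinvariant := S.frequently_isInvariant hψ N
  obtain ⟨ϱ, hϱ, hfix, hlim⟩ :=
    QuantumKac.CollisionSpec.exists_tendsto_traceNorm_evolution hN hinvariant hϱ₀
  exact ⟨ϱ, hϱ, hgenerator.2 hfix, hseparable hϱ hfix, hlim⟩
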